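/- Let $q\in\mathbb{C}$ with $0<|q|<1$, let $q^{1/3}$ denote any cube root of $q$, and interpret fractional powers of $q$ as powers of this root: $q^{m/3}=(q^{1/3})^m$ for $m\in\mathbb{Z}$ (so $q^{n(n+1)/6}=(q^{1/3})^{n(n+1)/2}$). Let $\omega$ be a primitive cube root of unity, and let $(a;q)_\infty=\prod_{n\ge 0}(1-aq^n)$. For $0<|q|<1$ define the tenth order mock theta functions by \[ \begin{aligned} \phi(q) &= \frac{1}{\sum_{n\in\mathbb{Z}} (-1)^n q^{n^2}} \Bigl( \sum_{r,s \geq 0} - \sum_{r,s <0} \Bigr) (-1)^{r+s} q^{r^2+3rs+s^2 +r+s},\\ \psi(q) &= \frac{1}{\sum_{n\in\mathbb{Z}} (-1)^n q^{n^2}} \Bigl( \sum_{r,s \geq 0} - \sum_{r,s <0} \Bigr) (-1)^{r+s+1} q^{r^2+3rs+s^2 +3r+3s+2},\\ X(q) &= \frac{2}{\sum_{n\in\mathbb{Z}} q^{n(n+1)/2}} \Bigl( \sum_{r,s \geq 0} - \sum_{r,s <0} \Bigr) q^{2r^2+6rs+2s^2 +r+s},\\ \chi(q) &= 2- \frac{2q}{\sum_{n\in\mathbb{Z}}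 q^{n(n+1)/2}} \Bigl( \sum_{r,s \geq 0} - \sum_{r,s <0} \Bigr) q^{2r^2+6rs+2s^2 -3r-3s}. \end{aligned} \] Then the first four of Ramanujan's tenth order identities hold: \[ \begin{aligned} q^{2/3} \phi (q^3) - \frac{\psi(\omega q^{1/3}) - \psi(\omega^2 q^{1/3})}{\omega-\omega^2} &= - q^{1/3} \frac{\sum_{n\in\mathbb{Z}} (-1)^n q^{n^2/3}}{\sum_{n\in\mathbb{Z}} (-1)^n q^{n^2}}\cdot\frac{\sum_{n\in\mathbb{Z}} (-1)^n q^{5n^2/2 +3n/2}}{(q;q^2)_\infty},\\ q^{-2/3} \psi (q^3) + \frac{\omega\phi(\omega q^{1/3}) - \omega^2 \phi(\omega^2 q^{1/3})}{\omega-\omega^2} &= \frac{\sum_{n\in\mathbb{Z}} (-1)^n q^{n^2/3}}{\sum_{n\in\mathbb{Z}} (-1)^n q^{n^2}}\cdot\frac{\sum_{n\in\mathbb{Z}} (-1)^n q^{5n^2/2 +n/2}}{(q;q^2)_\infty},\\ X(q^3) - \frac{\omega\chi(\omega q^{1/3}) - \omega^2 \chi(\omega^2 q^{1/3})}{\omega-\omega^2}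 &= \frac{\sum_{n\in\mathbb{Z}} q^{n(n+1)/6}}{\sum_{n\in\mathbb{Z}} q^{n(n+1)/2}}\cdot\frac{\sum_{n\in\mathbb{Z}} (-1)^n q^{5n^2 +n}}{(-q;q)_\infty},\\ \chi(q^3) + q^{2/3}\, \frac{X(\omega q^{1/3}) - X(\omega^2 q^{1/3})}{\omega-\omega^2} &= -q\,\frac{\sum_{n\in\mathbb{Z}} q^{n(n+1)/6}}{\sum_{n\in\mathbb{Z}} q^{n(n+1)/2}}\cdot\frac{\sum_{n\in\mathbb{Z}} (-1)^n q^{5n^2 +3n}}{(-q;q)_\infty}. \end{aligned} \] -/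

import Mathlib

noncomputable section

namespace TenthOrder

/-- The sign `ρ_{r,s}`: `1` if `r, s ≥ 0`, `-1` if `r, s < 0`, and `0` otherwise. -/
def rho (r s : ℤ) : ℤ :=
  if 0 ≤ r ∧ 0 ≤ s then 1 else if r < 0 ∧ s < 0 then -1 else 0

/-- The indefinite double sum `(∑_{r,s ≥ 0} - ∑_{r,s < 0}) f(r,s)`. -/
def indefSum (f : ℤ → ℤ → ℂ) : ℂ :=
  ∑' p : ℤ × ℤ, (rho p.1 p.2 : ℂ) * f p.1 p.2

/-- `∑_{n ∈ ℤ} (-1)^n q^{n^2}`. -/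
def thetaAlt (q : ℂ) : ℂ :=
  ∑' n : ℤ, (-1 : ℂ) ^ n * q ^ (n ^ 2)

/-- `∑_{n ∈ ℤ} q^{n(n+1)/2}`; the exponent is always an integer, so the division is exact. -/
def thetaTri (q : ℂ) : ℂ :=
  ∑' n : ℤ, q ^ (n * (n + 1) / 2)

/-- The `q`-Pochhammer symbol `(a; q)_∞ = ∏_{n ≥ 0} (1 - a q^n)`. -/
def qPoch (a q : ℂ) : ℂ :=
  ∏' n : ℕ, (1 - a * q ^ n)

/-- The tenth order mock theta function `φ`. -/
def phi (q : ℂ) : ℂ :=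
  1 / thetaAlt q *
    indefSum fun r s => (-1 : ℂ) ^ (r + s) * q ^ (r ^ 2 + 3 * r * s + s ^ 2 + r + s)

/-- The tenth order mock theta function `ψ`. -/
def psi (q : ℂ) : ℂ :=
  1 / thetaAlt q *
    indefSum fun r s =>
      (-1 : ℂ) ^ (r + s + 1) * q ^ (r ^ 2 + 3 * r * s + s ^ 2 + 3 * r + 3 * s + 2)

/-- The tenth order mock theta function `X`. -/
def bigX (q : ℂ) : ℂ :=
  2 / thetaTri q *
    indefSum fun r s => q ^ (2 * r ^ 2 + 6 * r * s + 2 * s ^ 2 + r + s)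

/-- The tenth order mock theta function `χ`. -/
def chi (q : ℂ) : ℂ :=
  2 - 2 * q / thetaTri q *
    indefSum fun r s => q ^ (2 * r ^ 2 + 6 * r * s + 2 * s ^ 2 - 3 * r - 3 * s)

end TenthOrder

end

noncomputable section

namespace TenthOrder

/-! Write $\rho$ for the sign in the double sums, $E(q)=(q;q)_\infty$ and
$\alpha_n=(-1)^nq^{n(n-1)/2}$ for the coefficients of Jacobi's theta function. The engine is the
classical expansion of $\sum\rho_{r,s}q^{rs}a^rb^s$ as $E(q)^3$ times a quotient of one theta
function by two, used in coefficient form: $\sum_{r,s}\rho_{r,s}q^{rs}\alpha_{r-m}\alpha_{s-n}$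
vanishes for $m\ne n$ and equals $E(q)^3\alpha_{m+1}$ for $m=n$ (`kernCoeff_of_ne`,
`kernCoeff_self`, `kernCoeff_zero_zero`). Hence, if $c=\alpha*\beta$ is a convolution,
$\sum\rho_{r,s}q^{rs}c_{r+k}c_{s+k}$ collapses to the single series
$E(q)^3\sum_m\beta_m^2\alpha_{m-k+1}$ (`tsum_kern_mul_thetaMul`).

Take for $\beta$ the terms of a suitable second theta series. The coefficients $c_n$ are then
quasi-periodic with period 3, so with $x=q^{1/3}$ they are, up to a common factor, a sign and a
power of $x$ quadratic in $n$, times one of two constants $A$, $-B$ chosen by $n$ mod 3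
(`altCoeff_eq`, `triCoeff_eq`). These powers combine with $q^{rs}=x^{3rs}$ to give exactly the mock
theta exponents at $x$. Sorting exponents mod 3 into parts $P_i,P_j,P_k$ turns the collapsed sum
into an evaluation of $A^2P_i-ABP_j+B^2P_k$ (the `bilinear_` lemmas).

The same constants occur in the denominators: the trisected theta function at $\omega x$ is
$A+\omega B$, and $(A+\omega B)(A+\omega^2B)=A^2-AB+B^2$. The residue part whose indices lie in one
fixed class mod 3 is, up to a power of $x$ and boundary terms, the double sum of the companion
function at $q^3$. Putting the left side of each identity over a common denominator therefore
leaves, up to a constant and a power of $x$, precisely the evaluated bilinear form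
(`root_combination_left`, `root_combination_right`), and the denominators multiply to a fourth power
of a theta function at $q$ (`thetaAlt_cube_product`, `thetaTri_cube_product`). -/

/-! ### Infinite products $(a;q)_\infty$ and their dissections. -/

lemma summable_norm_mul_pow (a : ℂ) {q : ℂ} (hq : ‖q‖ < 1) :
    Summable fun n : ℕ => ‖-(a * q ^ n)‖ := by
  simp only [norm_neg, norm_mul, norm_pow]
  exact (summable_geometric_of_lt_one (norm_nonneg q) hq).mul_left _

lemma multipliable_qPoch (a : ℂ) {q : ℂ} (hq : ‖q‖ < 1) :
    Multipliable fun n : ℕ => 1 - a * q ^ n := by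
  simpa only [sub_eq_add_neg] using
    multipliable_one_add_of_summable (summable_norm_mul_pow a hq)

lemma hasProd_qPoch (a : ℂ) {q : ℂ} (hq : ‖q‖ < 1) :
    HasProd (fun n : ℕ => 1 - a * q ^ n) (qPoch a q) :=
  (multipliable_qPoch a hq).hasProd

lemma qPoch_ne_zero {a q : ℂ} (hq : ‖q‖ < 1) (h : ∀ n : ℕ, a * q ^ n ≠ 1) : qPoch a q ≠ 0 := by
  have := tprod_one_add_ne_zero_of_summable (f := fun n : ℕ => -(a * q ^ n))
    (fun n hn => h n (by linear_combination -hn)) (summable_norm_mul_pow a hq)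
  simpa only [qPoch, ← sub_eq_add_neg] using this

lemma qPoch_ne_zero_of_norm_lt {a q : ℂ} (hq : ‖q‖ < 1) (ha : ‖a‖ < 1) : qPoch a q ≠ 0 := by
  refine qPoch_ne_zero hq fun n hn => ?_
  have h1 : ‖a * q ^ n‖ < 1 := by
    rw [norm_mul, norm_pow]
    exact (mul_le_of_le_one_right (norm_nonneg _) (pow_le_one₀ (norm_nonneg _) hq.le)).trans_lt ha
  rw [hn, norm_one] at h1
  exact lt_irrefl _ h1

lemma norm_pow_lt_one {q : ℂ} (hq : ‖q‖ < 1) {k : ℕ} (hk : k ≠ 0) : ‖q ^ k‖ < 1 := by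
  rw [norm_pow]
  exact pow_lt_one₀ (norm_nonneg _) hq hk

/-- The factors are sorted by the residue of the index mod `k`. -/
lemma qPoch_eq_prod (a : ℂ) {q : ℂ} (hq : ‖q‖ < 1) (k : ℕ) [NeZero k] :
    qPoch a q = ∏ i : Fin k, qPoch (a * q ^ (i : ℕ)) (q ^ k) := by
  have h1 := hasProd_qPoch a hq
  rw [← (Nat.divModEquiv k).symm.hasProd_iff,
    ← (Equiv.prodComm (Fin k) ℕ).hasProd_iff] at h1
  have h2 : ∀ i : Fin k, HasProd (fun n => (((fun n : ℕ => 1 - a * q ^ n) ∘ (Nat.divModEquiv k).symm) ∘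
      Equiv.prodComm (Fin k) ℕ) (i, n)) (qPoch (a * q ^ (i : ℕ)) (q ^ k)) := fun i => by
    convert hasProd_qPoch (a * q ^ (i : ℕ)) (norm_pow_lt_one hq (NeZero.ne k)) using 2 with n
    simp [Nat.divModEquiv]
    ring
  exact (h1.prod_fiberwise h2).unique (hasProd_fintype _)

lemma qPoch_mul_neg (a : ℂ) {q : ℂ} (hq : ‖q‖ < 1) :
    qPoch a q * qPoch (-a) q = qPoch (a ^ 2) (q ^ 2) := by
  rw [qPoch, qPoch, ← (multipliable_qPoch a hq).tprod_mul (multipliable_qPoch (-a) hq), qPoch]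
  exact tprod_congr fun n => by ring

lemma one_add_add_sq {ω : ℂ} (hω : IsPrimitiveRoot ω 3) : 1 + ω + ω ^ 2 = 0 := by
  have := hω.geom_sum_eq_zero (by norm_num)
  simpa [Finset.sum_range_succ] using this

lemma qPoch_mul_cube (a : ℂ) {q ω : ℂ} (hq : ‖q‖ < 1) (hω : IsPrimitiveRoot ω 3) :
    qPoch a q * qPoch (ω * a) q * qPoch (ω ^ 2 * a) q = qPoch (a ^ 3) (q ^ 3) := by
  have h := one_add_add_sq hω
  have h3 := hω.pow_eq_one
  rw [qPoch, qPoch, qPoch, ← (multipliable_qPoch a hq).tprod_mul (multipliable_qPoch (ω * a) hq),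
    ← ((multipliable_qPoch a hq).mul (multipliable_qPoch (ω * a) hq)).tprod_mul
      (multipliable_qPoch (ω ^ 2 * a) hq), qPoch]
  refine tprod_congr fun n => ?_
  rw [← pow_mul, mul_comm 3 n, pow_mul]
  linear_combination (-(a * q ^ n) + (a * q ^ n) ^ 2 * ω) * h - (a * q ^ n) ^ 3 * h3

lemma qPoch_eq_one_sub_mul (a : ℂ) {q : ℂ} (hq : ‖q‖ < 1) :
    qPoch a q = (1 - a) * qPoch (a * q) q := by
  rw [qPoch, tprod_eq_zero_mul' (by
    simpa only [pow_succ', mul_assoc] using multipliable_qPoch (a * q) hq)]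
  simp [qPoch, pow_succ', mul_assoc]

lemma qPoch_self_eq_two {q : ℂ} (hq : ‖q‖ < 1) :
    qPoch q q = qPoch q (q ^ 2) * qPoch (q ^ 2) (q ^ 2) := by
  simpa [Fin.prod_univ_two, ← sq] using qPoch_eq_prod q hq 2

lemma qPoch_self_ne_zero {q : ℂ} (hq : ‖q‖ < 1) : qPoch q q ≠ 0 :=
  qPoch_ne_zero_of_norm_lt hq hq

/-- Euler's identity. -/
lemma qPoch_odd_mul_qPoch_neg {q : ℂ} (hq : ‖q‖ < 1) : qPoch q (q ^ 2) * qPoch (-q) q = 1 := by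
  have h1 := qPoch_mul_neg q hq
  have h2 := qPoch_self_eq_two hq
  have h3 : qPoch (q ^ 2) (q ^ 2) ≠ 0 := qPoch_self_ne_zero (norm_pow_lt_one hq two_ne_zero)
  apply mul_right_cancel₀ h3
  linear_combination h1 - qPoch (-q) q * h2

/-! ### Summability over `ℤ` -/

lemma summable_pow_natAbs {r : ℝ} (h0 : 0 ≤ r) (h1 : r < 1) :
    Summable fun n : ℤ => r ^ n.natAbs := by
  apply Summable.of_nat_of_neg <;> simpa using summable_geometric_of_lt_one h0 h1

lemma zpow_le_of_natAbs_le {r : ℝ} (h0 : 0 < r) (h1 : r < 1) {e n C : ℤ} (h : |n| ≤ e + C) :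
    r ^ e ≤ r ^ (-C) * r ^ n.natAbs := by
  rw [← zpow_natCast, ← zpow_add₀ h0.ne', Int.natCast_natAbs]
  exact zpow_le_zpow_right_of_le_one₀ h0 h1.le (by linarith)

lemma summable_norm_zpow {x : ℂ} (hx0 : x ≠ 0) (hx1 : ‖x‖ < 1) {e : ℤ → ℤ} (C : ℤ)
    (he : ∀ n, |n| ≤ e n + C) : Summable fun n => ‖x ^ e n‖ := by
  have h0 : 0 < ‖x‖ := norm_pos_iff.mpr hx0
  refine Summable.of_nonneg_of_le (fun _ => norm_nonneg _) (fun n => ?_)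
    ((summable_pow_natAbs h0.le hx1).mul_left (‖x‖ ^ (-C)))
  rw [norm_zpow]
  exact zpow_le_of_natAbs_le h0 hx1 (he n)

lemma norm_neg_one_zpow (n : ℤ) : ‖(-1 : ℂ) ^ n‖ = 1 := by simp [norm_zpow]

lemma summable_norm_sign_zpow {x : ℂ} (hx0 : x ≠ 0) (hx1 : ‖x‖ < 1) {e s : ℤ → ℤ} (C : ℤ)
    (he : ∀ n, |n| ≤ e n + C) : Summable fun n => ‖(-1 : ℂ) ^ s n * x ^ e n‖ := by
  simpa only [norm_mul, norm_neg_one_zpow, one_mul] using summable_norm_zpow hx0 hx1 C he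

/-! ### The coefficients of the theta function -/

/-- The coefficients `(-1)^n q^{n(n-1)/2}` of Jacobi's triple product. -/
def alpha (q : ℂ) (n : ℤ) : ℂ := (-1 : ℂ) ^ n * q ^ (n * (n - 1) / 2)

lemma tri_succ (n : ℤ) : (n + 1) * n / 2 = n * (n - 1) / 2 + n := by
  rw [show (n + 1) * n = n * (n - 1) + n * 2 by ring, Int.add_mul_ediv_right _ _ two_ne_zero]

lemma two_mul_tri (n : ℤ) : 2 * (n * (n - 1) / 2) = n * (n - 1) :=
  Int.mul_ediv_cancel' (by simpa [mul_comm] using (Int.even_mul_pred_self n).two_dvd)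

lemma alpha_zero (q : ℂ) : alpha q 0 = 1 := by simp [alpha]

lemma alpha_succ {q : ℂ} (hq : q ≠ 0) (n : ℤ) : alpha q (n + 1) = -q ^ n * alpha q n := by
  rw [alpha, alpha, add_sub_cancel_right, tri_succ, zpow_add₀ hq, zpow_add₀ (by norm_num), zpow_one]
  ring

lemma alpha_pred {q : ℂ} (hq : q ≠ 0) (n : ℤ) :
    alpha q (n - 1) = -q ^ (1 - n) * alpha q n := by
  have h := alpha_succ hq (n - 1)
  rw [sub_add_cancel] at h
  rw [h, ← mul_assoc, neg_mul_neg, ← zpow_add₀ hq]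
  simp

lemma alpha_one_sub (q : ℂ) (n : ℤ) : alpha q (1 - n) = -alpha q n := by
  rw [alpha, alpha, show (1 - n) * (1 - n - 1) = n * (n - 1) by ring, zpow_sub₀ (by norm_num),
    zpow_one, div_eq_mul_inv, ← inv_zpow]
  norm_num

lemma summable_norm_alpha_mul_zpow {q z : ℂ} (hq0 : q ≠ 0) (hq1 : ‖q‖ < 1) (hz : z ≠ 0) :
    Summable fun n => ‖alpha q n * z ^ n‖ := by
  have h0 : 0 < ‖q‖ := norm_pos_iff.mpr hq0
  have hz0 : 0 < ‖z‖ := norm_pos_iff.mpr hz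
  -- With this `k` both `‖z‖` and its inverse are at most `‖q‖ ^ (-k)`, so `z ^ n` costs only a
  -- linear exponent against the quadratic one in `alpha`. The constant `(k + 2) ^ 2` below comes
  -- from completing the square.
  obtain ⟨k, hk⟩ := exists_pow_lt_of_lt_one (lt_min hz0 (inv_pos.mpr hz0)) hq1
  obtain ⟨hk1, hk2⟩ := lt_min_iff.mp hk
  have hbound : ∀ n : ℤ, ‖z‖ ^ n ≤ ‖q‖ ^ (-(k * |n|)) := fun n => by
    have hpos : 0 < ‖q‖ ^ k := pow_pos h0 k
    rw [zpow_neg, zpow_mul, zpow_natCast, ← inv_zpow]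
    obtain ⟨m, rfl | rfl⟩ := n.eq_nat_or_neg
    · rw [Nat.abs_cast, zpow_natCast, zpow_natCast]
      exact pow_le_pow_left₀ hz0.le ((le_inv_comm₀ hpos hz0).mp hk2.le) m
    · rw [abs_neg, Nat.abs_cast, zpow_neg, zpow_natCast, zpow_natCast, ← inv_pow]
      exact pow_le_pow_left₀ (inv_nonneg.mpr hz0.le) (inv_anti₀ hpos hk1.le) m
  refine Summable.of_nonneg_of_le (fun _ => norm_nonneg _) (fun n => ?_)
    ((summable_pow_natAbs h0.le hq1).mul_left (‖q‖ ^ (-((k : ℤ) + 2) ^ 2)))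
  rw [alpha, norm_mul, norm_mul, norm_neg_one_zpow, one_mul, norm_zpow, norm_zpow]
  refine (mul_le_mul_of_nonneg_left (hbound n) (zpow_nonneg h0.le _)).trans ?_
  rw [← zpow_add₀ h0.ne']
  refine zpow_le_of_natAbs_le h0 hq1 ?_
  have h2 := two_mul_tri n
  have h3 := sq_abs n
  have h4 := le_abs_self n
  nlinarith [sq_nonneg (|n| - ((k : ℤ) + 2))]

lemma summable_norm_alpha {q : ℂ} (hq0 : q ≠ 0) (hq1 : ‖q‖ < 1) :
    Summable fun n => ‖alpha q n‖ := by
  simpa using summable_norm_alpha_mul_zpow hq0 hq1 one_ne_zero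

/-- The reflection `n ↦ 1 - n` negates every term: the theta function vanishes at `z = 1`. -/
lemma tsum_alpha (q : ℂ) : ∑' n, alpha q n = 0 := by
  have h := (Equiv.subLeft (1 : ℤ)).tsum_eq (alpha q)
  simp only [Equiv.subLeft_apply, alpha_one_sub, tsum_neg] at h
  exact self_eq_neg.mp h.symm

/-! ### Jacobi's triple product -/

/-- The finite product `(q; q)_n`. -/
def pochFin (q : ℂ) (n : ℕ) : ℂ := ∏ k ∈ Finset.range n, (1 - q ^ (k + 1))

/-- The reciprocal of `(q; q)_n`, which is zero for negative `n`. -/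
def invPoch (q : ℂ) (n : ℤ) : ℂ := if n < 0 then 0 else (pochFin q n.toNat)⁻¹

lemma pow_succ_ne_one {q : ℂ} (hq1 : ‖q‖ < 1) (k : ℕ) : q ^ (k + 1) ≠ 1 := fun h => by
  have := norm_pow_lt_one hq1 k.succ_ne_zero
  rw [Nat.succ_eq_add_one, h, norm_one] at this
  exact lt_irrefl _ this

lemma pochFin_ne_zero {q : ℂ} (hq1 : ‖q‖ < 1) (n : ℕ) : pochFin q n ≠ 0 :=
  Finset.prod_ne_zero_iff.mpr fun k _ => sub_ne_zero.mpr (pow_succ_ne_one hq1 k).symm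

lemma pochFin_succ (q : ℂ) (n : ℕ) : pochFin q (n + 1) = pochFin q n * (1 - q ^ (n + 1)) :=
  Finset.prod_range_succ _ _

/-- Extending by zero to negative indices keeps the recurrence valid on all of `ℤ`; at `n = 0` the
factor `1 - q ^ 0` vanishes. -/
lemma invPoch_pred {q : ℂ} (hq1 : ‖q‖ < 1) (n : ℤ) :
    invPoch q (n - 1) = (1 - q ^ n) * invPoch q n := by
  rcases lt_trichotomy n 0 with h | h | h
  · simp [invPoch, h, show n - 1 < 0 by omega]
  · simp [invPoch, h]
  · obtain ⟨m, rfl⟩ : ∃ m : ℕ, n = m + 1 := ⟨(n - 1).toNat, by omega⟩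
    have h1 := pochFin_ne_zero hq1 m
    have h2 := sub_ne_zero.mpr (pow_succ_ne_one hq1 m).symm
    rw [invPoch, invPoch, if_neg (by omega), if_neg (by omega), add_sub_cancel_right,
      show ((m : ℤ) + 1).toNat = m + 1 by omega, Int.toNat_natCast, pochFin_succ,
      show ((m : ℤ) + 1) = ((m + 1 : ℕ) : ℤ) by push_cast; rfl, zpow_natCast]
    field_simp

/-- The coefficients of the finite form of Jacobi's triple product. -/
def finCoeff (q : ℂ) (N : ℕ) (n : ℤ) : ℂ :=
  pochFin q (2 * N) * invPoch q (N + n) * invPoch q (N - n) * alpha q n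

/-- This is multiplication of the finite product by its next factor,
$(1-zq^N)(1-q^{N+1}/z)=1+q^{2N+1}-q^Nz-q^{N+1}/z$, read on coefficients. -/
lemma finCoeff_succ {q : ℂ} (hq0 : q ≠ 0) (hq1 : ‖q‖ < 1) (N : ℕ) (n : ℤ) :
    finCoeff q (N + 1) n = (1 + q ^ (2 * N + 1)) * finCoeff q N n
      - q ^ N * finCoeff q N (n - 1) - q ^ (N + 1) * finCoeff q N (n + 1) := by
  have e1 := invPoch_pred hq1 (N + 1 + n)
  have e2 := invPoch_pred hq1 (N + n)
  have e3 := invPoch_pred hq1 (N + 1 - n)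
  have e4 := invPoch_pred hq1 (N - n)
  have hn := zpow_ne_zero n hq0
  rw [show (N : ℤ) + 1 + n - 1 = N + n by ring] at e1
  rw [show (N : ℤ) + 1 - n - 1 = N - n by ring] at e3
  simp only [finCoeff, alpha_succ hq0, alpha_pred hq0]
  rw [show (N : ℤ) + (n - 1) = N + n - 1 by ring, show (N : ℤ) - (n - 1) = N + 1 - n by ring,
    show (N : ℤ) + (n + 1) = N + 1 + n by ring, show (N : ℤ) - (n + 1) = N - n - 1 by ring,
    e2, e4, e1, e3, show 2 * (N + 1) = 2 * N + 1 + 1 by ring, pochFin_succ, pochFin_succ]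
  push_cast
  simp only [zpow_add₀ hq0, zpow_sub₀ hq0, zpow_one, zpow_natCast]
  field_simp
  ring_nf

lemma hasSum_finCoeff_zero (q : ℂ) (f : ℤ → ℂ) :
    HasSum (fun n => finCoeff q 0 n * f n) (f 0) := by
  have h : ∀ n ≠ 0, finCoeff q 0 n * f n = 0 := fun n hn => by
    rcases lt_or_gt_of_ne hn with h | h
    · simp [finCoeff, invPoch, h]
    · simp [finCoeff, invPoch, h]
  simpa [finCoeff, invPoch, pochFin, alpha_zero] using hasSum_single (0 : ℤ) h

/-- The finite form of Jacobi's triple product. -/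
lemma hasSum_finCoeff {q z : ℂ} (hq0 : q ≠ 0) (hq1 : ‖q‖ < 1) (hz : z ≠ 0) (N : ℕ) :
    HasSum (fun n => finCoeff q N n * z ^ n)
      (∏ k ∈ Finset.range N, ((1 - z * q ^ k) * (1 - q / z * q ^ k))) := by
  induction N with
  | zero => simpa using hasSum_finCoeff_zero q fun n => z ^ n
  | succ N ih =>
    have h1 := (Equiv.subRight (1 : ℤ)).hasSum_iff.mpr ih
    have h2 := (Equiv.addRight (1 : ℤ)).hasSum_iff.mpr ih
    rw [Finset.prod_range_succ]
    convert ((ih.mul_left (1 + q ^ (2 * N + 1))).sub (h1.mul_left (q ^ N * z))).sub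
      (h2.mul_left (q ^ (N + 1) / z)) using 1
    · rfl
    · ext n
      simp only [Function.comp, Equiv.subRight_apply, Equiv.coe_addRight, finCoeff_succ hq0 hq1,
        zpow_add₀ hz, zpow_sub₀ hz, zpow_one]
      field_simp
    · generalize (∏ k ∈ Finset.range N, (1 - z * q ^ k) * (1 - q / z * q ^ k)) = p
      field_simp
      ring

/-- This is $z\,d/dz$ of the finite triple product at `z = 1`, where only the derivative of the
factor `1 - z` survives. It is proved by a recurrence coupling the derivative `t` to the value `s`.
-/
lemma hasSum_mul_finCoeff {q : ℂ} (hq0 : q ≠ 0) (hq1 : ‖q‖ < 1) (N : ℕ) :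
    HasSum (fun n => finCoeff q (N + 1) n * n) (-(pochFin q N * pochFin q (N + 1))) := by
  have step : ∀ (N : ℕ) (s t : ℂ), HasSum (fun n => finCoeff q N n) s →
      HasSum (fun n => finCoeff q N n * n) t →
      HasSum (fun n => finCoeff q (N + 1) n * n)
        ((1 - q ^ N) * (1 - q ^ (N + 1)) * t + (q ^ (N + 1) - q ^ N) * s) := fun N s t hs ht => by
    have h1 := (Equiv.subRight (1 : ℤ)).hasSum_iff.mpr ht
    have h2 := (Equiv.addRight (1 : ℤ)).hasSum_iff.mpr ht
    have h3 := (Equiv.subRight (1 : ℤ)).hasSum_iff.mpr hs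
    have h4 := (Equiv.addRight (1 : ℤ)).hasSum_iff.mpr hs
    convert ((ht.mul_left (1 + q ^ (2 * N + 1))).sub ((h1.add h3).mul_left (q ^ N))).sub
      ((h2.sub h4).mul_left (q ^ (N + 1))) using 1
    · rfl
    · ext n
      simp only [Function.comp, Equiv.subRight_apply, Equiv.coe_addRight, finCoeff_succ hq0 hq1]
      push_cast
      ring
    · ring
  induction N with
  | zero =>
    -- For `N = 0` the product is empty: value 1, derivative 0.
    have := step 0 1 0 (by simpa using hasSum_finCoeff_zero q fun _ => 1)
      (by simpa using hasSum_finCoeff_zero q fun n => n)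
    convert this using 1
    simp [pochFin]
  | succ N ih =>
    have := step (N + 1) 0 _ (by
      have := hasSum_finCoeff hq0 hq1 one_ne_zero (N + 1)
      -- The factor `k = 0` makes the value at `z = 1` zero from the second step on.
      rw [Finset.prod_eq_zero (Finset.mem_range.mpr N.succ_pos) (by simp)] at this
      simpa using this) ih
    convert this using 1
    rw [pochFin_succ q (N + 1), pochFin_succ q N]
    ring

lemma tendsto_pochFin {q : ℂ} (hq1 : ‖q‖ < 1) :
    Filter.Tendsto (pochFin q) Filter.atTop (nhds (qPoch q q)) := by
  unfold pochFin
  simpa only [pochFin, pow_succ'] using (hasProd_qPoch q hq1).tendsto_prod_nat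

lemma tendsto_invPoch {q : ℂ} (hq1 : ‖q‖ < 1) :
    Filter.Tendsto (invPoch q) Filter.atTop (nhds (qPoch q q)⁻¹) := by
  have h : Filter.Tendsto (fun n : ℤ => n.toNat) Filter.atTop Filter.atTop :=
    Filter.tendsto_atTop_atTop.mpr fun b => ⟨b, fun a ha => by omega⟩
  refine (((tendsto_pochFin hq1).comp h).inv₀ (qPoch_self_ne_zero hq1)).congr' ?_
  filter_upwards [Filter.eventually_ge_atTop 0] with n hn
  simp [invPoch, not_lt.mpr hn]

lemma exists_norm_pochFin_le {q : ℂ} (hq1 : ‖q‖ < 1) : ∃ C, ∀ n, ‖pochFin q n‖ ≤ C :=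
  ((tendsto_pochFin hq1).norm.isBoundedUnder_le.bddAbove_range).imp fun _ hC n => hC ⟨n, rfl⟩

lemma exists_norm_invPoch_le {q : ℂ} (hq1 : ‖q‖ < 1) : ∃ C, ∀ n, ‖invPoch q n‖ ≤ C := by
  obtain ⟨C, hC⟩ := ((tendsto_pochFin hq1).inv₀
    (qPoch_self_ne_zero hq1)).norm.isBoundedUnder_le.bddAbove_range
  have hC' : ∀ n, ‖(pochFin q n)⁻¹‖ ≤ C := fun n => hC ⟨n, rfl⟩
  refine ⟨C, fun n => ?_⟩
  unfold invPoch
  split_ifs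
  · simpa using (norm_nonneg _).trans (hC' 0)
  · exact hC' _

/-- Each `finCoeff q N n` tends to `alpha q n / (q; q)_∞`, and the bounds on `(q; q)_n` and its
reciprocal give a dominating series uniform in `N`. -/
lemma tendsto_tsum_finCoeff {q : ℂ} (hq1 : ‖q‖ < 1) {f : ℤ → ℂ}
    (hf : Summable fun n => ‖alpha q n * f n‖) :
    Filter.Tendsto (fun N => ∑' n, finCoeff q N n * f n) Filter.atTop
      (nhds ((qPoch q q)⁻¹ * ∑' n, alpha q n * f n)) := by
  obtain ⟨C, hC⟩ := exists_norm_pochFin_le hq1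
  obtain ⟨D, hD⟩ := exists_norm_invPoch_le hq1
  have hE := qPoch_self_ne_zero hq1
  have hC0 : 0 ≤ C := (norm_nonneg _).trans (hC 0)
  have hD0 : 0 ≤ D := (norm_nonneg _).trans (hD 0)
  rw [← tsum_mul_left]
  refine tendsto_tsum_of_dominated_convergence (hf.mul_left (C * D * D)) (fun n => ?_)
    (Filter.Eventually.of_forall fun N n => ?_)
  · have h1 : Filter.Tendsto (fun N : ℕ => (N : ℤ) + n) Filter.atTop Filter.atTop :=
      Filter.tendsto_atTop_add_const_right _ _ tendsto_natCast_atTop_atTop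
    have h2 : Filter.Tendsto (fun N : ℕ => (N : ℤ) - n) Filter.atTop Filter.atTop :=
      Filter.tendsto_atTop_add_const_right _ _ tendsto_natCast_atTop_atTop
    have h3 : Filter.Tendsto (fun N : ℕ => 2 * N) Filter.atTop Filter.atTop :=
      Filter.tendsto_id.const_mul_atTop' two_pos
    have := ((((tendsto_pochFin hq1).comp h3).mul ((tendsto_invPoch hq1).comp h1)).mul
      ((tendsto_invPoch hq1).comp h2)).mul_const (alpha q n * f n)
    rw [mul_inv_cancel₀ hE, one_mul] at this
    refine this.congr fun N => ?_
    simp only [Function.comp, finCoeff]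
    ring
  · rw [finCoeff, mul_assoc, norm_mul, norm_mul, norm_mul]
    gcongr
    · exact hC _
    · exact hD _
    · exact hD _

/-- Jacobi's triple product. -/
theorem tsum_alpha_mul_zpow {q z : ℂ} (hq0 : q ≠ 0) (hq1 : ‖q‖ < 1) (hz : z ≠ 0) :
    ∑' n, alpha q n * z ^ n = qPoch q q * qPoch z q * qPoch (q / z) q := by
  have h1 := tendsto_tsum_finCoeff hq1 (summable_norm_alpha_mul_zpow hq0 hq1 hz)
  have h2 := (hasProd_qPoch z hq1).tendsto_prod_nat.mul (hasProd_qPoch (q / z) hq1).tendsto_prod_nat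
  simp only [← Finset.prod_mul_distrib] at h2
  have h3 := tendsto_nhds_unique h1 (h2.congr fun N => ((hasSum_finCoeff hq0 hq1 hz N).tsum_eq).symm)
  have hE := qPoch_self_ne_zero hq1
  rw [inv_mul_eq_iff_eq_mul₀ hE] at h3
  rw [h3, mul_assoc]

lemma summable_norm_alpha_mul_of_le {q : ℂ} {t : ℝ} (hq0 : q ≠ 0) (hq1 : ‖q‖ < 1) (ht : 0 < t)
    {f : ℤ → ℝ} (hf0 : ∀ n, 0 ≤ f n) (hf : ∀ n, f n ≤ t ^ n + t ^ (-n)) :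
    Summable fun n : ℤ => ‖alpha q n‖ * f n := by
  have h1 := summable_norm_alpha_mul_zpow hq0 hq1 (z := t) (by exact_mod_cast ht.ne')
  have h2 := summable_norm_alpha_mul_zpow hq0 hq1 (z := (t : ℂ)⁻¹) (by
    exact inv_ne_zero (by exact_mod_cast ht.ne'))
  refine Summable.of_nonneg_of_le (fun n => mul_nonneg (norm_nonneg _) (hf0 n)) (fun n => ?_)
    (h1.add h2)
  rw [norm_mul, norm_mul, ← mul_add, norm_zpow, norm_zpow, norm_inv, Complex.norm_real,
    Real.norm_of_nonneg ht.le, inv_zpow, ← zpow_neg]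
  exact mul_le_mul_of_nonneg_left (hf n) (norm_nonneg _)

lemma summable_norm_alpha_mul_int {q : ℂ} (hq0 : q ≠ 0) (hq1 : ‖q‖ < 1) :
    Summable fun n : ℤ => ‖alpha q n * n‖ := by
  simp only [norm_mul]
  refine summable_norm_alpha_mul_of_le hq0 hq1 (t := 2) two_pos (fun _ => norm_nonneg _) fun n => ?_
  have h : ∀ m : ℕ, (m : ℝ) ≤ 2 ^ m := fun m => by exact_mod_cast Nat.lt_two_pow_self.le
  obtain ⟨m, rfl | rfl⟩ := n.eq_nat_or_neg
  · simpa using (h m).trans (le_add_of_nonneg_right (by positivity))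
  · simpa using (h m).trans (le_add_of_nonneg_left (by positivity))

/-- Jacobi's identity for the cube of Euler's product. -/
theorem tsum_alpha_mul_int {q : ℂ} (hq0 : q ≠ 0) (hq1 : ‖q‖ < 1) :
    ∑' n : ℤ, alpha q n * n = -qPoch q q ^ 3 := by
  have h1 := (tendsto_tsum_finCoeff hq1 (summable_norm_alpha_mul_int hq0 hq1)).comp
    (Filter.tendsto_add_atTop_nat 1)
  have h2 := ((tendsto_pochFin hq1).mul
    ((tendsto_pochFin hq1).comp (Filter.tendsto_add_atTop_nat 1))).neg
  have h3 := tendsto_nhds_unique h1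
    (h2.congr fun N => ((hasSum_mul_finCoeff hq0 hq1 N).tsum_eq).symm)
  rw [inv_mul_eq_iff_eq_mul₀ (qPoch_self_ne_zero hq1)] at h3
  rw [h3]
  ring

/-! ### The kernel `ρ(r,s) q^{rs}` -/

/-- The kernel `ρ(r,s) q^{rs}`. -/
def kern (q : ℂ) (r s : ℤ) : ℂ := rho r s * q ^ (r * s)

lemma rho_comm (r s : ℤ) : rho r s = rho s r := by
  simp only [rho, and_comm]

lemma rho_succ (r s : ℤ) : rho r (s + 1) = rho r s + if s = -1 then 1 else 0 := by
  unfold rho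
  split_ifs <;> omega

lemma kern_comm (q : ℂ) (r s : ℤ) : kern q r s = kern q s r := by
  rw [kern, kern, rho_comm, mul_comm r s]

lemma norm_kern_le {q : ℂ} (hq0 : q ≠ 0) (hq1 : ‖q‖ < 1) (r s : ℤ) : ‖kern q r s‖ ≤ 1 := by
  have h0 : 0 < ‖q‖ := norm_pos_iff.mpr hq0
  have h : 0 ≤ r * s → ‖q‖ ^ (r * s) ≤ 1 := fun h => by
    simpa using zpow_le_zpow_right_of_le_one₀ h0 hq1.le h
  rw [kern, norm_mul, norm_zpow]
  unfold rho
  split_ifs with h1 h2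
  · simpa using h (mul_nonneg h1.1 h1.2)
  · simpa using h (mul_nonneg_of_nonpos_of_nonpos h2.1.le h2.2.le)
  · simp

lemma summable_norm_kern_mul {q : ℂ} (hq0 : q ≠ 0) (hq1 : ‖q‖ < 1) {f g : ℤ → ℂ}
    (hf : Summable fun n => ‖f n‖) (hg : Summable fun n => ‖g n‖) :
    Summable fun p : ℤ × ℤ => ‖kern q p.1 p.2 * (f p.1 * g p.2)‖ := by
  refine Summable.of_nonneg_of_le (fun _ => norm_nonneg _) (fun p => ?_)
    (hf.mul_of_nonneg hg (fun _ => norm_nonneg _) fun _ => norm_nonneg _)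
  rw [norm_mul, norm_mul]
  exact mul_le_of_le_one_left (by positivity) (norm_kern_le hq0 hq1 _ _)

lemma summable_norm_alpha_sub {q : ℂ} (hq0 : q ≠ 0) (hq1 : ‖q‖ < 1) (m : ℤ) :
    Summable fun n => ‖alpha q (n - m)‖ :=
  (Equiv.subRight m).summable_iff.mpr (summable_norm_alpha hq0 hq1)

lemma tsum_alpha_sub (q : ℂ) (m : ℤ) : ∑' n, alpha q (n - m) = 0 :=
  ((Equiv.subRight m).tsum_eq (alpha q)).trans (tsum_alpha q)

/-- The coefficients of the product of the kernel with two theta functions. -/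
def kernCoeff (q : ℂ) (m n : ℤ) : ℂ :=
  ∑' p : ℤ × ℤ, kern q p.1 p.2 * (alpha q (p.1 - m) * alpha q (p.2 - n))

lemma summable_kernCoeff {q : ℂ} (hq0 : q ≠ 0) (hq1 : ‖q‖ < 1) (m n : ℤ) :
    Summable fun p : ℤ × ℤ => kern q p.1 p.2 * (alpha q (p.1 - m) * alpha q (p.2 - n)) :=
  (summable_norm_kern_mul hq0 hq1 (summable_norm_alpha_sub hq0 hq1 m)
    (summable_norm_alpha_sub hq0 hq1 n)).of_norm

lemma kernCoeff_comm (q : ℂ) (m n : ℤ) : kernCoeff q m n = kernCoeff q n m := by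
  rw [kernCoeff, ← (Equiv.prodComm ℤ ℤ).tsum_eq]
  exact tsum_congr fun p => by
    simp only [Equiv.prodComm_apply, Prod.fst_swap, Prod.snd_swap, kern_comm q p.2 p.1]
    ring

/-- Shifting `s` by one multiplies the kernel by `q ^ r`, which the theta coefficients absorb by
`alpha_pred`. The jump of `rho` at `s = -1` adds one row, which is a multiple of `∑ alpha = 0`. -/
lemma kernCoeff_succ {q : ℂ} (hq0 : q ≠ 0) (hq1 : ‖q‖ < 1) (m n : ℤ) :
    kernCoeff q (m + 1) n = -q ^ (m + 1) * kernCoeff q m (n - 1) := by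
  have hinj : Function.Injective fun r : ℤ => (r, (-1 : ℤ)) := fun a b h => (Prod.mk.inj h).1
  -- The jump row `s = -1`.
  have h1 : HasSum (fun p : ℤ × ℤ =>
      if p.2 = -1 then alpha q (p.1 - (m + 1)) * alpha q (-n) else 0) 0 := by
    rw [← hinj.hasSum_iff]
    · have := ((summable_norm_alpha_sub hq0 hq1 (m + 1)).of_norm.hasSum).mul_right (alpha q (-n))
      rw [tsum_alpha_sub, zero_mul] at this
      simpa [Function.comp_def] using this
    · rintro ⟨r, s⟩ hs
      refine if_neg fun h => hs ⟨r, ?_⟩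
      simpa using h.symm
  have h2 := (((summable_kernCoeff hq0 hq1 m (n - 1)).hasSum.mul_left (-q ^ (m + 1))).add h1).tsum_eq
  rw [add_zero] at h2
  rw [kernCoeff, ← ((Equiv.refl ℤ).prodCongr (Equiv.addRight 1)).tsum_eq, kernCoeff, ← h2]
  refine tsum_congr fun ⟨r, s⟩ => ?_
  simp only [Equiv.prodCongr_apply, Prod.map, Equiv.refl_apply, Equiv.coe_addRight, kern, rho_succ]
  have h3 : alpha q (r - (m + 1)) = -q ^ (1 - (r - m)) * alpha q (r - m) := by
    rw [← alpha_pred hq0]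
    congr 1
    ring
  rw [show s + 1 - n = s - (n - 1) by ring]
  split_ifs with hs
  · subst hs
    rw [show -1 - (n - 1) = -n by ring, h3]
    simp only [mul_neg, mul_one, neg_add_cancel, mul_zero, zpow_zero, zpow_sub₀ hq0, zpow_one,
      zpow_add₀ hq0, zpow_neg]
    push_cast
    field_simp
    ring
  · rw [h3, mul_add, mul_one]
    simp only [zpow_sub₀ hq0, zpow_one, zpow_add₀ hq0]
    push_cast
    field_simp
    ring

lemma zpow_injective_of_norm_lt {q : ℂ} (hq0 : q ≠ 0) (hq1 : ‖q‖ < 1) :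
    Function.Injective fun n : ℤ => q ^ n := fun a b h => by
  have h1 := congrArg norm h
  simp only [norm_zpow] at h1
  exact zpow_right_injective₀ (norm_pos_iff.mpr hq0) hq1.ne h1

lemma kernCoeff_succ_succ {q : ℂ} (hq0 : q ≠ 0) (hq1 : ‖q‖ < 1) (m n : ℤ) :
    kernCoeff q (m + 1) (n + 1) = -q ^ (m + 1) * kernCoeff q m n := by
  rw [kernCoeff_succ hq0 hq1, add_sub_cancel_right]

/-- Shifting both indices gives the factor `-q ^ (m + 1)`; by symmetry it is also `-q ^ (n + 1)`.
These differ when `m ≠ n`. -/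
lemma kernCoeff_of_ne {q : ℂ} (hq0 : q ≠ 0) (hq1 : ‖q‖ < 1) {m n : ℤ} (h : m ≠ n) :
    kernCoeff q m n = 0 := by
  have h1 := kernCoeff_succ_succ hq0 hq1 m n
  rw [kernCoeff_comm, kernCoeff_succ_succ hq0 hq1, kernCoeff_comm] at h1
  have h2 : q ^ (m + 1) - q ^ (n + 1) ≠ 0 := sub_ne_zero.mpr fun h3 =>
    h (add_right_cancel (zpow_injective_of_norm_lt hq0 hq1 h3))
  exact (mul_eq_zero.mp (by linear_combination h1 : _ * kernCoeff q m n = 0)).resolve_left h2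

lemma kernCoeff_self {q : ℂ} (hq0 : q ≠ 0) (hq1 : ‖q‖ < 1) (m : ℤ) :
    kernCoeff q m m = -alpha q (m + 1) * kernCoeff q 0 0 := by
  induction m with
  | zero =>
    have := alpha_one_sub q 0
    rw [sub_zero, alpha_zero] at this
    simp [this]
  | succ m ih =>
    rw [kernCoeff_succ_succ hq0 hq1, ih, alpha_succ hq0 (m + 1)]
    ring
  | pred m ih =>
    have h1 := kernCoeff_succ_succ hq0 hq1 (-m - 1) (-m - 1)
    have h2 := alpha_succ hq0 (-m - 1 + 1)
    rw [sub_add_cancel] at h1 h2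
    rw [h1, h2] at ih
    have h3 : -q ^ (-m : ℤ) ≠ 0 := neg_ne_zero.mpr (zpow_ne_zero _ hq0)
    rw [sub_add_cancel]
    apply mul_left_cancel₀ h3
    rw [ih]
    ring

/-- A signed count of the integers between `-k` and `0`; this is how the weight `n` of Jacobi's cube
identity arises. -/
lemma hasSum_step (k : ℤ) :
    HasSum (fun m : ℤ => ((if 0 ≤ k + m then 1 else 0) - if 0 ≤ m then 1 else 0 : ℂ)) k := by
  induction k with
  | zero => simp [hasSum_zero]
  | succ k ih =>
    convert ih.add (hasSum_ite_eq (-(k : ℤ) - 1) (1 : ℂ)) using 1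
    · ext m
      split_ifs <;> first | omega | simp
    · push_cast; rfl
  | pred k ih =>
    convert ih.sub (hasSum_ite_eq (k : ℤ) (1 : ℂ)) using 1
    · rfl
    · ext m
      split_ifs <;> first | omega | simp
    · push_cast; rfl

lemma summable_step {q : ℂ} (hq0 : q ≠ 0) (hq1 : ‖q‖ < 1) :
    Summable fun p : ℤ × ℤ =>
      ((if 0 ≤ p.2 + p.1 then 1 else 0) - if 0 ≤ p.1 then 1 else 0 : ℂ) * alpha q p.2 := by
  have h0 : 0 < ‖q‖ := norm_pos_iff.mpr hq0
  have h1 : Summable fun n : ℤ => ‖alpha q n‖ * ‖q‖ ^ (-|n|) :=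
    summable_norm_alpha_mul_of_le hq0 hq1 h0 (fun n => zpow_nonneg h0.le _) fun n => by
      rcases abs_choice n with h | h <;> rw [h]
      · exact le_add_of_nonneg_left (zpow_nonneg h0.le _)
      · rw [neg_neg]
        exact le_add_of_nonneg_right (zpow_nonneg h0.le _)
  refine Summable.of_norm_bounded ((summable_pow_natAbs h0.le hq1).mul_of_nonneg h1
    (fun n => pow_nonneg h0.le _)
    fun n => mul_nonneg (norm_nonneg _) (zpow_nonneg h0.le _)) fun ⟨m, k⟩ => ?_
  have h2 : ‖((if 0 ≤ k + m then 1 else 0) - if 0 ≤ m then 1 else 0 : ℂ)‖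
      ≤ ‖q‖ ^ m.natAbs * ‖q‖ ^ (-|k|) := by
    have h3 : |m| ≤ |k| → 1 ≤ ‖q‖ ^ m.natAbs * ‖q‖ ^ (-|k|) := fun h => by
      rw [← zpow_natCast, Int.natCast_natAbs, ← zpow_add₀ h0.ne']
      exact one_le_zpow_of_nonpos₀ h0 hq1.le (by linarith)
    have h4 : 0 ≤ ‖q‖ ^ m.natAbs * ‖q‖ ^ (-|k|) := by positivity
    have h5 : (0 ≤ k + m ∧ ¬0 ≤ m ∨ ¬0 ≤ k + m ∧ 0 ≤ m) → |m| ≤ |k| := fun h => by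
      rcases abs_cases m with h' | h' <;> rcases abs_cases k with h'' | h'' <;> omega
    split_ifs with ha hb hb
    · simpa using h4
    · simpa using h3 (h5 (.inl ⟨ha, hb⟩))
    · simpa using h3 (h5 (.inr ⟨ha, hb⟩))
    · simpa using h4
  rw [norm_mul]
  calc _ ≤ ‖q‖ ^ m.natAbs * ‖q‖ ^ (-|k|) * ‖alpha q k‖ :=
        mul_le_mul_of_nonneg_right h2 (norm_nonneg _)
    _ = _ := by ring

lemma tsum_comm_of_summable {β γ : Type*} {F : β × γ → ℂ} (hF : Summable F) :
    ∑' b, ∑' c, F (b, c) = ∑' c, ∑' b, F (b, c) :=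
  (Summable.tsum_comm (f := fun b c => F (b, c)) hF).symm

/-- The kernel without its terms with `s = 0`. -/
def kern' (q : ℂ) (r s : ℤ) : ℂ := kern q r s - if s = 0 then (if 0 ≤ r then 1 else 0) else 0

lemma norm_kern'_le {q : ℂ} (hq0 : q ≠ 0) (hq1 : ‖q‖ < 1) (r s : ℤ) :
    ‖kern' q r s‖ ≤ ‖q‖ ^ r.natAbs := by
  have h0 : 0 < ‖q‖ := norm_pos_iff.mpr hq0
  have h : |r| ≤ r * s → ‖q‖ ^ (r * s) ≤ ‖q‖ ^ r.natAbs := fun h => by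
    rw [← zpow_natCast, Int.natCast_natAbs]
    exact zpow_le_zpow_right_of_le_one₀ h0 hq1.le h
  by_cases hs : s = 0
  · subst hs
    by_cases hr : 0 ≤ r <;> simp [kern', kern, rho, hr]
  simp only [kern', hs, if_false, sub_zero, kern, norm_mul, norm_zpow]
  unfold rho
  split_ifs with h1 h2
  · simpa using h (by rw [abs_of_nonneg h1.1]; exact le_mul_of_one_le_right h1.1 (by omega))
  · simpa using h (by rw [abs_of_neg h2.1]; nlinarith)
  · simp

/-- Since off-diagonal coefficients vanish, the value equals `∑ m, kernCoeff q m 0`. Summing over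
`m` first would give zero, but the row `s = 0` has no decay in `r`, so the interchange fails there.
The kernel without that row does contribute zero; the row itself contributes `∑ k * alpha q k`,
which is Jacobi's identity for the cube. -/
lemma kernCoeff_zero_zero {q : ℂ} (hq0 : q ≠ 0) (hq1 : ‖q‖ < 1) :
    kernCoeff q 0 0 = -qPoch q q ^ 3 := by
  have h0 : 0 < ‖q‖ := norm_pos_iff.mpr hq0
  have hα := summable_norm_alpha hq0 hq1
  set F : ℤ × (ℤ × ℤ) → ℂ := fun t =>
    kern' q t.2.1 t.2.2 * (alpha q (t.2.1 - t.1) * alpha q t.2.2) with hFdef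
  have hF : Summable F := by
    let e : ℤ × (ℤ × ℤ) ≃ ℤ × (ℤ × ℤ) :=
      { toFun := fun t => (t.2.1 - t.1, t.2)
        invFun := fun t => (t.2.1 - t.1, t.2)
        left_inv := fun t => by simp
        right_inv := fun t => by simp }
    have h1 := hα.mul_of_nonneg ((summable_pow_natAbs h0.le hq1).mul_of_nonneg hα
      (fun n => pow_nonneg h0.le _) fun _ => norm_nonneg _) (fun _ => norm_nonneg _)
      fun p => mul_nonneg (pow_nonneg h0.le _) (norm_nonneg _)
    refine Summable.of_norm_bounded (e.summable_iff.mpr h1) fun ⟨m, r, s⟩ => ?_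
    simp only [F, e, Function.comp, Equiv.coe_fn_mk, norm_mul]
    calc _ ≤ ‖q‖ ^ r.natAbs * (‖alpha q (r - m)‖ * ‖alpha q s‖) :=
          mul_le_mul_of_nonneg_right (norm_kern'_le hq0 hq1 r s) (by positivity)
      _ = _ := by ring
  have hF0 : ∑' m, ∑' p, F (m, p) = 0 := by
    rw [tsum_comm_of_summable hF]
    have : ∀ p : ℤ × ℤ, ∑' m, F (m, p) = 0 := fun p => by
      simp only [F]
      have h1 := (Equiv.subLeft p.1).tsum_eq (alpha q)
      simp only [Equiv.subLeft_apply, tsum_alpha] at h1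
      rw [tsum_mul_left, tsum_mul_right, h1]
      simp
    simp [this]
  have hG := summable_step hq0 hq1
  clear_value F
  -- Subtracting the indicator of `0 ≤ m` changes no inner sum, as `∑ alpha = 0`, but makes the
  -- double series absolutely convergent.
  have hG0 : ∑' m : ℤ, ∑' k : ℤ,
      ((if 0 ≤ k + m then 1 else 0) - if 0 ≤ m then 1 else 0 : ℂ) * alpha q k
      = -qPoch q q ^ 3 := by
    rw [tsum_comm_of_summable hG, ← tsum_alpha_mul_int hq0 hq1]
    refine tsum_congr fun k => ?_
    simp only
    rw [tsum_mul_right, (hasSum_step k).tsum_eq, mul_comm]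
  have hS : ∀ m, kernCoeff q m 0 = ∑' p, F (m, p) + ∑' k : ℤ,
      ((if 0 ≤ k + m then 1 else 0) - if 0 ≤ m then 1 else 0 : ℂ) * alpha q k := fun m => by
    have hinj : Function.Injective fun k : ℤ => (k + m, (0 : ℤ)) := fun a b h =>
      add_right_cancel (Prod.mk.inj h).1
    have h1 : Summable fun k : ℤ => (if 0 ≤ m then 1 else 0 : ℂ) * alpha q k :=
      hα.of_norm.mul_left _
    have h2 := ((hG.prod_factor m).hasSum).add h1.hasSum
    rw [tsum_mul_left, tsum_alpha, mul_zero, add_zero] at h2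
    have h3 : HasSum (fun p : ℤ × ℤ => if p.2 = 0 then
        (if 0 ≤ p.1 then 1 else 0) * alpha q (p.1 - m) else 0) (∑' k : ℤ,
      ((if 0 ≤ k + m then 1 else 0) - if 0 ≤ m then 1 else 0 : ℂ) * alpha q k) := by
      rw [← hinj.hasSum_iff]
      · convert h2 using 1
        · rfl
        ext k
        simp only [Function.comp, if_true, add_sub_cancel_right]
        ring
      · rintro ⟨r, s⟩ hs
        refine if_neg fun h => hs ⟨r - m, ?_⟩
        simpa using h.symm
    rw [← ((hF.prod_factor m).hasSum.add h3).tsum_eq, kernCoeff]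
    refine tsum_congr fun ⟨r, s⟩ => ?_
    simp only [hFdef, kern', sub_zero]
    by_cases hs : s = 0
    · simp only [hs, if_true, alpha_zero]
      ring
    · simp [hs]
  have h1 : ∑' m, kernCoeff q m 0 = kernCoeff q 0 0 :=
    tsum_eq_single 0 fun m hm => kernCoeff_of_ne hq0 hq1 hm
  rw [← h1, ← hG0]
  simp only [hS]
  rw [Summable.tsum_add hF.prod hG.prod, hF0, zero_add]

/-! ### Collapse of the double sum for convolutions with a theta function. -/

/-- The coefficients of the product of the theta function `∑ alpha q n u^n` with `∑ β n u^n`. -/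
def thetaMul (q : ℂ) (β : ℤ → ℂ) (n : ℤ) : ℂ := ∑' m, alpha q (n - m) * β m

lemma summable_alpha_sub_mul {q : ℂ} (hq0 : q ≠ 0) (hq1 : ‖q‖ < 1) {β : ℤ → ℂ}
    (hβ : Summable fun n => ‖β n‖) (k : ℤ) :
    Summable fun p : ℤ × ℤ => ‖alpha q (p.1 + k - p.2) * β p.2‖ := by
  let e : ℤ × ℤ ≃ ℤ × ℤ :=
    { toFun := fun t => (t.1 + k - t.2, t.2)
      invFun := fun t => (t.1 + t.2 - k, t.2)
      left_inv := fun t => by ext <;> simp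
      right_inv := fun t => by ext <;> simp }
  have h1 := (summable_norm_alpha hq0 hq1).mul_of_nonneg hβ (fun _ => norm_nonneg _)
    fun _ => norm_nonneg _
  refine (e.summable_iff.mpr h1).congr fun p => ?_
  simp [e]

/-- Expanding both convolutions and summing over `p` first leaves `kernCoeff q (m - k) (n - k)`, so
only the diagonal `m = n` survives. -/
theorem tsum_kern_mul_thetaMul {q : ℂ} (hq0 : q ≠ 0) (hq1 : ‖q‖ < 1) {β : ℤ → ℂ}
    (hβ : Summable fun n => ‖β n‖) (k : ℤ) :
    ∑' p : ℤ × ℤ, kern q p.1 p.2 * (thetaMul q β (p.1 + k) * thetaMul q β (p.2 + k))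
      = qPoch q q ^ 3 * ∑' m, β m ^ 2 * alpha q (m - k + 1) := by
  let G : (ℤ × ℤ) × (ℤ × ℤ) → ℂ := fun t => kern q t.1.1 t.1.2 *
    (alpha q (t.1.1 + k - t.2.1) * β t.2.1 * (alpha q (t.1.2 + k - t.2.2) * β t.2.2))
  have h1 := summable_alpha_sub_mul hq0 hq1 hβ k
  have hG : Summable G := by
    refine Summable.of_norm_bounded ((Equiv.prodProdProdComm ℤ ℤ ℤ ℤ).summable_iff.mpr
      (h1.mul_of_nonneg h1 (fun _ => norm_nonneg _) fun _ => norm_nonneg _)) fun t => ?_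
    simp only [G, Function.comp, Equiv.prodProdProdComm_apply]
    rw [norm_mul, norm_mul (_ * _)]
    exact mul_le_of_le_one_left (by positivity) (norm_kern_le hq0 hq1 _ _)
  have hL : ∀ p : ℤ × ℤ, kern q p.1 p.2 * (thetaMul q β (p.1 + k) * thetaMul q β (p.2 + k))
      = ∑' t, G (p, t) := fun p => by
    rw [thetaMul, thetaMul, tsum_mul_tsum_of_summable_norm (h1.prod_factor p.1)
      (h1.prod_factor p.2), ← tsum_mul_left]
  have hR : ∀ t : ℤ × ℤ, ∑' p, G (p, t) = β t.1 * β t.2 * kernCoeff q (t.1 - k) (t.2 - k) :=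
    fun t => by
      rw [kernCoeff, ← tsum_mul_left]
      refine tsum_congr fun p => ?_
      simp only [G, sub_sub_eq_add_sub]
      ring
  simp only [hL]
  rw [tsum_comm_of_summable hG]
  simp only [hR]
  have hinj : Function.Injective fun m : ℤ => (m, m) := fun a b h => (Prod.mk.inj h).1
  rw [← hinj.tsum_eq, ← tsum_mul_left]
  · refine tsum_congr fun m => ?_
    rw [kernCoeff_self hq0 hq1, kernCoeff_zero_zero hq0 hq1]
    ring
  · rintro ⟨m, n⟩ h
    by_contra hne
    refine h ?_
    have : m - k ≠ n - k := fun h2 => hne ⟨m, by simp [sub_left_injective h2]⟩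
    simp [kernCoeff_of_ne hq0 hq1 this]

/-! ### Theta functions -/

/-- `∑_{n ∈ ℤ} q^{n(3n+1)/2}`. -/
def thetaPent (q : ℂ) : ℂ := ∑' n : ℤ, q ^ (n * (3 * n + 1) / 2)

/-- `∑_{n ∈ ℤ} (-1)^n q^{3n²+2n}`. -/
def thetaOct (q : ℂ) : ℂ := ∑' n : ℤ, (-1 : ℂ) ^ n * q ^ (3 * n ^ 2 + 2 * n)

lemma two_mul_tri' (n : ℤ) : 2 * (n * (n + 1) / 2) = n * (n + 1) :=
  Int.mul_ediv_cancel' (Int.even_mul_succ_self n).two_dvd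

lemma two_mul_pent (n : ℤ) : 2 * (n * (3 * n + 1) / 2) = n * (3 * n + 1) := by
  refine Int.mul_ediv_cancel' ?_
  rw [show n * (3 * n + 1) = n * (n + 1) + 2 * n ^ 2 by ring]
  exact dvd_add (Int.even_mul_succ_self n).two_dvd (dvd_mul_right _ _)

lemma alpha_pow_mul_zpow {q : ℂ} (hq0 : q ≠ 0) (k j : ℕ) (n : ℤ) :
    alpha (q ^ k) n * (q ^ j) ^ n = (-1) ^ n * q ^ (k * (n * (n - 1) / 2) + j * n) := by
  rw [alpha, zpow_add₀ hq0, zpow_mul, zpow_mul, zpow_natCast, zpow_natCast, mul_assoc]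

lemma neg_one_zpow_mul_self (n : ℤ) : (-1 : ℂ) ^ n * (-1) ^ n = 1 := by
  rw [← mul_zpow]; norm_num

lemma alpha_pow_mul_neg_zpow {q : ℂ} (hq0 : q ≠ 0) (k j : ℕ) (n : ℤ) :
    alpha (q ^ k) n * (-q ^ j) ^ n = q ^ (k * (n * (n - 1) / 2) + j * n) := by
  rw [← neg_one_mul (q ^ j), mul_zpow, mul_left_comm, alpha_pow_mul_zpow hq0, ← mul_assoc,
    neg_one_zpow_mul_self, one_mul]

section
variable {q : ℂ} (hq0 : q ≠ 0) (hq1 : ‖q‖ < 1)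
include hq0 hq1

lemma thetaAlt_eq : thetaAlt q = qPoch q q * qPoch q (q ^ 2) := by
  have h := tsum_alpha_mul_zpow (pow_ne_zero 2 hq0) (norm_pow_lt_one hq1 two_ne_zero)
    (pow_ne_zero 1 hq0)
  simp only [alpha_pow_mul_zpow hq0] at h
  rw [thetaAlt, qPoch_self_eq_two hq1]
  convert h using 1
  · refine tsum_congr fun n => ?_
    congr 2
    push_cast
    linear_combination -two_mul_tri n
  · rw [show q ^ 2 / q ^ 1 = q by field_simp, pow_one]
    ring

lemma thetaTri_eq : thetaTri q = 2 * qPoch q q * qPoch (-q) q ^ 2 := by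
  have h := tsum_alpha_mul_zpow (pow_ne_zero 1 hq0) (norm_pow_lt_one hq1 one_ne_zero)
    (neg_ne_zero.mpr (pow_ne_zero 1 hq0))
  simp only [alpha_pow_mul_neg_zpow hq0] at h
  rw [thetaTri]
  convert h using 1
  · refine tsum_congr fun n => ?_
    congr 1
    have h1 := tri_succ n
    rw [mul_comm] at h1
    push_cast
    linear_combination h1
  · rw [show q ^ 1 / -q ^ 1 = -1 by field_simp, pow_one, qPoch_eq_one_sub_mul (-1) hq1]
    ring_nf

lemma thetaPent_eq :
    thetaPent q = qPoch (q ^ 3) (q ^ 3) * qPoch (-q ^ 2) (q ^ 3) * qPoch (-q) (q ^ 3) := by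
  have h := tsum_alpha_mul_zpow (pow_ne_zero 3 hq0) (norm_pow_lt_one hq1 three_ne_zero)
    (neg_ne_zero.mpr (pow_ne_zero 2 hq0))
  simp only [alpha_pow_mul_neg_zpow hq0] at h
  rw [show q ^ 3 / -q ^ 2 = -q by field_simp] at h
  rw [← h, thetaPent]
  refine tsum_congr fun n => ?_
  congr 1
  push_cast
  have := two_mul_pent n
  have := two_mul_tri n
  linarith

lemma thetaOct_eq :
    thetaOct q = qPoch (q ^ 6) (q ^ 6) * qPoch (q ^ 5) (q ^ 6) * qPoch q (q ^ 6) := by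
  have h := tsum_alpha_mul_zpow (pow_ne_zero 6 hq0) (norm_pow_lt_one hq1 (by norm_num))
    (pow_ne_zero 5 hq0)
  simp only [alpha_pow_mul_zpow hq0] at h
  rw [show q ^ 6 / q ^ 5 = q by field_simp] at h
  rw [← h, thetaOct]
  refine tsum_congr fun n => ?_
  congr 2
  push_cast
  linear_combination -3 * two_mul_tri n

/-- Split `(-q; q)_∞` mod 3 and apply Euler's identity at `q` and at `q ^ 3`. -/
lemma thetaAlt_cube : thetaAlt (q ^ 3) = qPoch q (q ^ 2) * thetaPent q := by
  have hy1 := norm_pow_lt_one hq1 three_ne_zero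
  have h1 := qPoch_eq_prod (-q) hq1 3
  have h2 := qPoch_odd_mul_qPoch_neg hq1
  have h3 := qPoch_odd_mul_qPoch_neg hy1
  have h4 : qPoch (-q ^ 3) (q ^ 3) ≠ 0 := qPoch_ne_zero_of_norm_lt hy1 (by rwa [norm_neg])
  simp only [Fin.prod_univ_three, Fin.val_zero, Fin.val_one, Fin.val_two, pow_zero, mul_one,
    pow_one] at h1
  rw [show -q * q = -q ^ 2 by ring, show -q * q ^ 2 = -q ^ 3 by ring] at h1
  rw [thetaAlt_eq (pow_ne_zero 3 hq0) hy1, thetaPent_eq hq0 hq1]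
  apply mul_right_cancel₀ h4
  rw [h1] at h2
  linear_combination qPoch (q ^ 3) (q ^ 3) * (h3 - h2)

/-- Split `(q; q²)_∞` mod 3; its middle class `(q³; q⁶)_∞` cancels one factor `(-q³; q³)_∞` by
Euler's identity. -/
lemma qPoch_mul_thetaTri_cube : qPoch q (q ^ 2) * thetaTri (q ^ 3) = 2 * thetaOct q := by
  have hy1 := norm_pow_lt_one hq1 three_ne_zero
  have h1 := qPoch_eq_prod q (norm_pow_lt_one hq1 two_ne_zero) 3
  have h3 := qPoch_odd_mul_qPoch_neg hy1
  have h4 := qPoch_mul_neg (q ^ 3) hy1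
  simp only [Fin.prod_univ_three, Fin.val_zero, Fin.val_one, Fin.val_two, mul_one,
    ← pow_mul] at h1 h3 h4
  rw [show q * q ^ 2 = q ^ 3 by ring, show q * q ^ (2 * 2) = q ^ 5 by ring] at h1
  rw [thetaTri_eq (pow_ne_zero 3 hq0) hy1, thetaOct_eq hq0 hq1, h1]
  norm_num at h3 h4 ⊢
  rw [← h4]
  linear_combination 2 * qPoch q (q ^ 6) * qPoch (q ^ 5) (q ^ 6) * qPoch (q ^ 3) (q ^ 3) *
    qPoch (-q ^ 3) (q ^ 3) * h3

lemma thetaAlt_mul_qPoch : thetaAlt q * qPoch (q ^ 2) (q ^ 2) = qPoch q q ^ 2 := by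
  rw [thetaAlt_eq hq0 hq1]
  linear_combination -qPoch q q * qPoch_self_eq_two hq1

lemma thetaTri_mul_qPoch : thetaTri q * qPoch q q = 2 * qPoch (q ^ 2) (q ^ 2) ^ 2 := by
  rw [thetaTri_eq hq0 hq1, ← qPoch_mul_neg q hq1]
  ring

lemma thetaAlt_ne_zero : thetaAlt q ≠ 0 := fun h => by
  have := thetaAlt_mul_qPoch hq0 hq1
  rw [h, zero_mul] at this
  exact pow_ne_zero 2 (qPoch_self_ne_zero hq1) this.symm

lemma thetaTri_ne_zero : thetaTri q ≠ 0 := fun h => by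
  have := thetaTri_mul_qPoch hq0 hq1
  rw [h, zero_mul] at this
  exact mul_ne_zero two_ne_zero
    (pow_ne_zero 2 (qPoch_self_ne_zero (norm_pow_lt_one hq1 two_ne_zero))) this.symm

end

/-! ### Products over the three cube roots of `q`. -/

lemma norm_lt_one_of_cube {x q : ℂ} (hq1 : ‖q‖ < 1) (hx : x ^ 3 = q) : ‖x‖ < 1 := by
  rw [← hx, norm_pow] at hq1
  exact (pow_lt_one_iff_of_nonneg (norm_nonneg _) three_ne_zero).mp hq1

lemma qPoch_self_eq_cube {x q : ℂ} (hq1 : ‖q‖ < 1) (hx : x ^ 3 = q) :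
    qPoch x x = qPoch x q * qPoch (x ^ 2) q * qPoch q q := by
  have h := qPoch_eq_prod x (norm_lt_one_of_cube hq1 hx) 3
  simpa [Fin.prod_univ_three, ← sq, ← pow_succ', hx] using h

section
variable {x q ω : ℂ} (hq1 : ‖q‖ < 1) (hx : x ^ 3 = q) (hω : IsPrimitiveRoot ω 3)
include hq1 hx hω

/-- Each Euler product at a cube root splits mod 3. Over the three roots the classes of `x` and `x ^
2` multiply to `(q; q³)_∞` and `(q²; q³)_∞`, which together with `(q³; q³)_∞` rebuild `(q; q)_∞`. -/
lemma qPoch_cube_product :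
    qPoch x x * qPoch (ω * x) (ω * x) * qPoch (ω ^ 2 * x) (ω ^ 2 * x) * qPoch (q ^ 3) (q ^ 3)
      = qPoch q q ^ 4 := by
  have h3 := hω.pow_eq_one
  have e0 := qPoch_self_eq_cube hq1 hx
  have e1 := qPoch_self_eq_cube (x := ω * x) hq1 (by rw [mul_pow, h3, hx, one_mul])
  have e2 := qPoch_self_eq_cube (x := ω ^ 2 * x) hq1 (by
    rw [mul_pow, ← pow_mul, mul_comm 2 3, pow_mul, h3, hx, one_pow, one_mul])
  have e3 := qPoch_self_eq_cube (x := q) (norm_pow_lt_one hq1 three_ne_zero) rfl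
  have c1 := qPoch_mul_cube x hq1 hω
  have c2 := qPoch_mul_cube (x ^ 2) hq1 hω
  rw [hx] at c1
  rw [show (x ^ 2) ^ 3 = q ^ 2 by rw [← hx]; ring] at c2
  rw [show (ω * x) ^ 2 = ω ^ 2 * x ^ 2 by ring] at e1
  rw [show (ω ^ 2 * x) ^ 2 = ω * x ^ 2 by linear_combination ω * x ^ 2 * h3] at e2
  rw [e0, e1, e2]
  rw [← c1, ← c2] at e3
  linear_combination -qPoch q q ^ 3 * e3

lemma qPoch_sq_cube_product :
    qPoch (x ^ 2) (x ^ 2) * qPoch ((ω * x) ^ 2) ((ω * x) ^ 2) *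
      qPoch ((ω ^ 2 * x) ^ 2) ((ω ^ 2 * x) ^ 2) * qPoch ((q ^ 3) ^ 2) ((q ^ 3) ^ 2)
      = qPoch (q ^ 2) (q ^ 2) ^ 4 := by
  have h3 := hω.pow_eq_one
  have h := qPoch_cube_product (norm_pow_lt_one hq1 two_ne_zero)
    (show (x ^ 2) ^ 3 = q ^ 2 by rw [← hx]; ring) hω
  rw [show (ω ^ 2 * x) ^ 2 = ω * x ^ 2 by linear_combination ω * x ^ 2 * h3, mul_pow ω x 2,
    show (q ^ 3) ^ 2 = (q ^ 2) ^ 3 by ring, ← h]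
  ring

variable (hq0 : q ≠ 0)
include hq0

lemma thetaAlt_cube_product :
    thetaAlt x * thetaAlt (ω * x) * thetaAlt (ω ^ 2 * x) * thetaAlt (q ^ 3) = thetaAlt q ^ 4 := by
  have hx0 : x ≠ 0 := fun h => hq0 (by rw [← hx, h]; ring)
  have hω0 := hω.ne_zero three_ne_zero
  have hx1 := norm_lt_one_of_cube hq1 hx
  have hω1 : ‖ω‖ = 1 := hω.norm'_eq_one three_ne_zero
  have t0 := thetaAlt_mul_qPoch hx0 hx1
  have t1 := thetaAlt_mul_qPoch (mul_ne_zero hω0 hx0) (by rwa [norm_mul, hω1, one_mul])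
  have t2 := thetaAlt_mul_qPoch (mul_ne_zero (pow_ne_zero 2 hω0) hx0)
    (by rwa [norm_mul, norm_pow, hω1, one_pow, one_mul])
  have t3 := thetaAlt_mul_qPoch (pow_ne_zero 3 hq0) (norm_pow_lt_one hq1 three_ne_zero)
  have t4 := thetaAlt_mul_qPoch hq0 hq1
  have hE := pow_ne_zero 4 (qPoch_self_ne_zero (norm_pow_lt_one hq1 two_ne_zero))
  apply mul_right_cancel₀ hE
  rw [← mul_pow, t4, ← pow_mul, mul_comm 2 4, pow_mul, ← qPoch_cube_product hq1 hx hω,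
    ← qPoch_sq_cube_product hq1 hx hω]
  have : ∀ a b c d e f g h A B C D : ℂ, a * e = A ^ 2 → b * f = B ^ 2 → c * g = C ^ 2 →
      d * h = D ^ 2 → a * b * c * d * (e * f * g * h) = (A * B * C * D) ^ 2 := by
    intro a b c d e f g h A B C D h1 h2 h3 h4
    calc _ = (a * e) * (b * f) * (c * g) * (d * h) := by ring
      _ = _ := by rw [h1, h2, h3, h4]; ring
  exact this _ _ _ _ _ _ _ _ _ _ _ _ t0 t1 t2 t3

lemma thetaTri_cube_product :
    thetaTri x * thetaTri (ω * x) * thetaTri (ω ^ 2 * x) * thetaTri (q ^ 3) = thetaTri q ^ 4 := by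
  have hx0 : x ≠ 0 := fun h => hq0 (by rw [← hx, h]; ring)
  have hω0 := hω.ne_zero three_ne_zero
  have hx1 := norm_lt_one_of_cube hq1 hx
  have hω1 : ‖ω‖ = 1 := hω.norm'_eq_one three_ne_zero
  have t0 := thetaTri_mul_qPoch hx0 hx1
  have t1 := thetaTri_mul_qPoch (mul_ne_zero hω0 hx0) (by rwa [norm_mul, hω1, one_mul])
  have t2 := thetaTri_mul_qPoch (mul_ne_zero (pow_ne_zero 2 hω0) hx0)
    (by rwa [norm_mul, norm_pow, hω1, one_pow, one_mul])
  have t3 := thetaTri_mul_qPoch (pow_ne_zero 3 hq0) (norm_pow_lt_one hq1 three_ne_zero)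
  have t4 := thetaTri_mul_qPoch hq0 hq1
  have hE := pow_ne_zero 4 (qPoch_self_ne_zero hq1)
  apply mul_right_cancel₀ hE
  rw [← mul_pow, t4, mul_pow, ← pow_mul, mul_comm 2 4, pow_mul, ← qPoch_cube_product hq1 hx hω,
    ← qPoch_sq_cube_product hq1 hx hω]
  have : ∀ a b c d e f g h A B C D : ℂ, a * e = 2 * A ^ 2 → b * f = 2 * B ^ 2 →
      c * g = 2 * C ^ 2 → d * h = 2 * D ^ 2 →
      a * b * c * d * (e * f * g * h) = 2 ^ 4 * (A * B * C * D) ^ 2 := by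
    intro a b c d e f g h A B C D h1 h2 h3 h4
    calc _ = (a * e) * (b * f) * (c * g) * (d * h) := by ring
      _ = _ := by rw [h1, h2, h3, h4]; ring
  exact this _ _ _ _ _ _ _ _ _ _ _ _ t0 t1 t2 t3

end

/-! ### Trisections -/

/-- The third class is written `-(3n) - 1` because the symmetries `n ↦ -n` and `n ↦ -1 - n` of the
theta exponents pair it with another class. -/
lemma tsum_int_trisection {f : ℤ → ℂ} (hf : Summable f) :
    ∑' n, f n = ∑' n, f (3 * n) + ∑' n, f (3 * n + 1) + ∑' n, f (-(3 * n) - 1) := by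
  have h1 := hf.hasSum
  rw [← (Int.divModEquiv 3).symm.hasSum_iff, ← (Equiv.prodComm (Fin 3) ℤ).hasSum_iff] at h1
  have h2 := h1.prod_fiberwise fun i => (h1.summable.prod_factor i).hasSum
  rw [(h2.unique (hasSum_fintype _)), Fin.sum_univ_three,
    ← (Equiv.subLeft (-1 : ℤ)).tsum_eq fun n => f (-(3 * n) - 1)]
  congr 1
  · congr 1
    · exact tsum_congr fun n => by simp [Int.divModEquiv, mul_comm]
    · exact tsum_congr fun n => by simp [Int.divModEquiv, mul_comm]
  · refine tsum_congr fun n => ?_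
    simp [Int.divModEquiv]
    congr 1
    ring

lemma zpow_three_mul {y q : ℂ} (hy : y ^ 3 = q) (e : ℤ) : y ^ (3 * e) = q ^ e := by
  rw [zpow_mul, ← hy]; rfl

lemma neg_one_zpow_three_mul (n : ℤ) : (-1 : ℂ) ^ (3 * n) = (-1) ^ n := by
  rw [zpow_mul]; norm_num

lemma summable_norm_thetaAlt {q : ℂ} (hq0 : q ≠ 0) (hq1 : ‖q‖ < 1) :
    Summable fun n : ℤ => ‖(-1 : ℂ) ^ n * q ^ (n ^ 2)‖ :=
  summable_norm_sign_zpow hq0 hq1 0 fun n => by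
    rw [add_zero, ← sq_abs]; nlinarith [Int.one_le_abs (z := n), abs_nonneg n]

lemma summable_norm_thetaTri {q : ℂ} (hq0 : q ≠ 0) (hq1 : ‖q‖ < 1) :
    Summable fun n : ℤ => ‖q ^ (n * (n + 1) / 2)‖ :=
  summable_norm_zpow hq0 hq1 2 fun n => by
    have := two_mul_tri' n
    rcases abs_cases n with h | h <;> nlinarith [sq_nonneg (2 * n - 1), sq_nonneg (2 * n + 3)]

lemma thetaAlt_trisection {y q : ℂ} (hq0 : q ≠ 0) (hq1 : ‖q‖ < 1) (hy : y ^ 3 = q) :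
    thetaAlt y = thetaAlt (q ^ 3) - 2 * y * thetaOct q := by
  have hy0 : y ≠ 0 := fun h => hq0 (by rw [← hy, h]; ring)
  rw [thetaAlt, tsum_int_trisection
    (summable_norm_thetaAlt hy0 (norm_lt_one_of_cube hq1 hy)).of_norm]
  have h1 : ∑' n : ℤ, (-1 : ℂ) ^ (3 * n + 1) * y ^ ((3 * n + 1) ^ 2) = -y * thetaOct q := by
    rw [thetaOct, ← tsum_mul_left]
    refine tsum_congr fun n => ?_
    rw [zpow_add₀ (by norm_num), neg_one_zpow_three_mul,
      show (3 * n + 1) ^ 2 = 3 * (3 * n ^ 2 + 2 * n) + 1 by ring, zpow_add₀ hy0, zpow_three_mul hy]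
    simp only [zpow_one]
    ring
  have h2 : ∑' n : ℤ, (-1 : ℂ) ^ (-(3 * n) - 1) * y ^ ((-(3 * n) - 1) ^ 2)
      = -y * thetaOct q := by
    rw [← h1]
    refine tsum_congr fun n => ?_
    rw [show (-(3 * n) - 1) ^ 2 = (3 * n + 1) ^ 2 by ring,
      show -(3 * n) - 1 = -(3 * n + 1) by ring, zpow_neg, ← inv_zpow]
    norm_num
  have h3 : ∑' n : ℤ, (-1 : ℂ) ^ (3 * n) * y ^ ((3 * n) ^ 2) = thetaAlt (q ^ 3) := by
    refine tsum_congr fun n => ?_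
    rw [neg_one_zpow_three_mul, show (3 * n) ^ 2 = 3 * (3 * n ^ 2) by ring, zpow_three_mul hy,
      zpow_three_mul rfl]
  rw [h1, h2, h3]
  ring

lemma thetaTri_trisection {y q : ℂ} (hq0 : q ≠ 0) (hq1 : ‖q‖ < 1) (hy : y ^ 3 = q) :
    thetaTri y = 2 * thetaPent q + y * thetaTri (q ^ 3) := by
  have hy0 : y ≠ 0 := fun h => hq0 (by rw [← hy, h]; ring)
  rw [thetaTri, tsum_int_trisection
    (summable_norm_thetaTri hy0 (norm_lt_one_of_cube hq1 hy)).of_norm]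
  have h1 : ∑' n : ℤ, y ^ ((3 * n + 1) * (3 * n + 1 + 1) / 2) = y * thetaTri (q ^ 3) := by
    rw [thetaTri, ← tsum_mul_left]
    refine tsum_congr fun n => ?_
    have e : (3 * n + 1) * (3 * n + 1 + 1) / 2 = 3 * (3 * (n * (n + 1) / 2)) + 1 := by
      have := two_mul_tri' (3 * n + 1)
      have := two_mul_tri' n
      linarith
    rw [e, zpow_add₀ hy0, zpow_three_mul hy, zpow_three_mul rfl, zpow_one, mul_comm]
  have h3 : ∑' n : ℤ, y ^ (3 * n * (3 * n + 1) / 2) = thetaPent q := by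
    refine tsum_congr fun n => ?_
    have e : 3 * n * (3 * n + 1) / 2 = 3 * (n * (3 * n + 1) / 2) := by
      have := two_mul_tri' (3 * n)
      have := two_mul_pent n
      linarith
    rw [e, zpow_three_mul hy]
  have h2 : ∑' n : ℤ, y ^ ((-(3 * n) - 1) * (-(3 * n) - 1 + 1) / 2) = thetaPent q := by
    rw [← h3]
    refine tsum_congr fun n => ?_
    rw [show (-(3 * n) - 1) * (-(3 * n) - 1 + 1) = 3 * n * (3 * n + 1) by ring]
  rw [h1, h2, h3]
  ring

/-! ### Products of two theta functions -/

/-- A first-order recurrence of step 3 with nonvanishing factor is determined by three consecutive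
values. -/
lemma eq_of_three_step {f g w : ℤ → ℂ} (hw : ∀ n, w n ≠ 0) (hf : ∀ n, f (n + 3) = w n * f n)
    (hg : ∀ n, g (n + 3) = w n * g n) (h0 : f 0 = g 0) (h1 : f 1 = g 1) (h2 : f 2 = g 2) (n : ℤ) :
    f n = g n := by
  have key : ∀ i, f i = g i → ∀ k : ℤ, f (3 * k + i) = g (3 * k + i) := fun i hi k => by
    induction k with
    | zero => simpa using hi
    | succ k ih =>
      rw [show 3 * ((k : ℤ) + 1) + i = 3 * k + i + 3 by ring, hf, hg, ih]
    | pred k ih =>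
      rw [show 3 * -(k : ℤ) + i = 3 * (-k - 1) + i + 3 by ring, hf, hg] at ih
      exact mul_left_cancel₀ (hw _) ih
  have hn : n = 3 * (n / 3) + n % 3 := by omega
  have h3 : n % 3 = 0 ∨ n % 3 = 1 ∨ n % 3 = 2 := by omega
  rw [hn]
  rcases h3 with h | h | h <;> rw [h]
  exacts [key 0 h0 _, key 1 h1 _, key 2 h2 _]

lemma alpha_add_two {q : ℂ} (hq0 : q ≠ 0) (n : ℤ) :
    alpha q (n + 2) = q ^ (2 * n + 1) * alpha q n := by
  rw [show n + 2 = n + 1 + 1 by ring, alpha_succ hq0, alpha_succ hq0, ← mul_assoc, neg_mul_neg,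
    ← zpow_add₀ hq0]
  ring_nf

lemma neg_one_zpow_neg (n : ℤ) : (-1 : ℂ) ^ (-n) = (-1) ^ n := by
  rw [zpow_neg, ← inv_zpow]; norm_num

/-- Raising `n` by 3 and `m` by 1 moves `alpha` by two steps and `β` by one; the dependence on `m`
cancels between the two factors. -/
lemma thetaMul_add_three {q : ℂ} (hq0 : q ≠ 0) {β : ℤ → ℂ} {c : ℂ} {d : ℤ}
    (hβ : ∀ m, β (m + 1) = c * q ^ (2 * m + d) * β m) (n : ℤ) :
    thetaMul q β (n + 3) = c * q ^ (2 * n + 1 + d) * thetaMul q β n := by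
  rw [thetaMul, ← (Equiv.addRight (1 : ℤ)).tsum_eq, thetaMul, ← tsum_mul_left]
  refine tsum_congr fun m => ?_
  rw [Equiv.coe_addRight, show n + 3 - (m + 1) = n - m + 2 by ring, alpha_add_two hq0, hβ,
    show 2 * n + 1 + d = 2 * (n - m) + 1 + (2 * m + d) by ring, zpow_add₀ hq0 (2 * (n - m) + 1)]
  ring

lemma thetaMul_two (q : ℂ) (β : ℤ → ℂ) : thetaMul q β 2 = -∑' m, alpha q m * β (m + 1) := by
  rw [thetaMul, ← (Equiv.addRight (1 : ℤ)).tsum_eq, ← tsum_neg]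
  refine tsum_congr fun m => ?_
  rw [Equiv.coe_addRight, show 2 - (m + 1) = 1 - m by ring, alpha_one_sub, neg_mul]

lemma thetaMul_one (q : ℂ) (β : ℤ → ℂ) : thetaMul q β 1 = -∑' m, alpha q m * β m := by
  rw [thetaMul, ← tsum_neg]
  exact tsum_congr fun m => by rw [alpha_one_sub, neg_mul]

lemma thetaMul_zero (q : ℂ) (β : ℤ → ℂ) : thetaMul q β 0 = ∑' m, alpha q m * β (-m) := by
  rw [thetaMul, ← (Equiv.neg ℤ).tsum_eq]
  exact tsum_congr fun m => by simp

/-- The summands of `thetaAlt q`. -/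
def altTerm (q : ℂ) (m : ℤ) : ℂ := (-1 : ℂ) ^ m * q ^ (m ^ 2)

/-- The summands of `∑ q^{2m²-m}`. -/
def triTerm (q : ℂ) (m : ℤ) : ℂ := q ^ (2 * m ^ 2 - m)

/-- The coefficients of a product of two theta functions, in terms of a cube root of the nome. -/
def altCoeff (x A B : ℂ) (n : ℤ) : ℂ :=
  (-1 : ℂ) ^ n * x ^ (n ^ 2 - n) * if n % 3 = 2 then -B else A

/-- The coefficients of a product of two theta functions, in terms of a cube root of the nome. -/
def triCoeff (x A B : ℂ) (n : ℤ) : ℂ :=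
  x ^ (2 * n ^ 2 - 3 * n) * if n % 3 = 0 then A else -B

section
variable {x q : ℂ} (hq0 : q ≠ 0) (hq1 : ‖q‖ < 1) (hx : x ^ 3 = q)
include hq0 hq1 hx

/-- Both sides gain `-q ^ (2 * n + 2)` under `n ↦ n + 3`, so the values at 0, 1, 2 decide. There the
convolution is `thetaPent q`, `-thetaPent q` and `q * thetaTri (q ^ 3)`, matched to the constants by
`thetaAlt_cube` and `qPoch_mul_thetaTri_cube`. -/
lemma altCoeff_eq (n : ℤ) : altCoeff x (thetaAlt (q ^ 3)) (-2 * x * thetaOct q) n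
    = qPoch q (q ^ 2) * thetaMul q (altTerm q) n := by
  have hx0 : x ≠ 0 := fun h => hq0 (by rw [← hx, h]; ring)
  have hp0 : thetaMul q (altTerm q) 0 = thetaPent q := by
    rw [thetaMul_zero, ← (Equiv.neg ℤ).tsum_eq, thetaPent]
    refine tsum_congr fun m => ?_
    simp only [Equiv.neg_apply, alpha, altTerm, neg_neg, neg_one_zpow_neg]
    rw [mul_mul_mul_comm, neg_one_zpow_mul_self, one_mul, ← zpow_add₀ hq0]
    congr 1
    have h1 := two_mul_tri (-m)
    have h2 := two_mul_pent m
    linarith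
  refine eq_of_three_step (f := altCoeff x _ _) (g := fun n => qPoch q (q ^ 2) *
    thetaMul q (altTerm q) n) (w := fun n => -1 * q ^ (2 * n + 1 + 1))
    (fun n => mul_ne_zero (neg_ne_zero.mpr one_ne_zero) (zpow_ne_zero _ hq0)) (fun n => ?_) (fun n => ?_)
    ?_ ?_ ?_ n
  · rw [altCoeff, altCoeff, Int.add_emod_right, ← zpow_three_mul hx, zpow_add₀ (by norm_num) n,
      show (n + 3) ^ 2 - (n + 3) = 3 * (2 * n + 1 + 1) + (n ^ 2 - n) by ring, zpow_add₀ hx0 (3 * _)]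
    norm_num
    ring_nf
  · rw [thetaMul_add_three hq0 (c := -1) (d := 1) fun m => ?_]
    · ring
    · rw [altTerm, altTerm, show (m + 1) ^ 2 = 2 * m + 1 + m ^ 2 by ring, zpow_add₀ hq0 (2 * m + 1),
        zpow_add₀ (by norm_num)]
      ring
  · rw [hp0, ← thetaAlt_cube hq0 hq1]
    simp [altCoeff]
  · have hp1 : thetaMul q (altTerm q) 1 = -thetaPent q := by
      rw [thetaMul_one, ← hp0, thetaMul_zero]
      simp only [altTerm, neg_one_zpow_neg, neg_sq]
    rw [hp1, mul_neg, ← thetaAlt_cube hq0 hq1]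
    simp [altCoeff]
  · have hp2 : thetaMul q (altTerm q) 2 = q * thetaTri (q ^ 3) := by
      rw [thetaMul_two, thetaTri, ← tsum_mul_left, ← tsum_neg]
      refine tsum_congr fun m => ?_
      rw [alpha, altTerm, zpow_add₀ (by norm_num), mul_mul_mul_comm, ← mul_assoc ((-1 : ℂ) ^ m),
        neg_one_zpow_mul_self, ← zpow_add₀ hq0, ← zpow_three_mul rfl]
      have h1 := two_mul_tri m
      have h2 := two_mul_tri' m
      rw [show m * (m - 1) / 2 + (m + 1) ^ 2 = 3 * (m * (m + 1) / 2) + 1 by linarith,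
        zpow_add₀ hq0]
      simp only [zpow_one]
      ring
    rw [hp2, mul_left_comm, qPoch_mul_thetaTri_cube hq0 hq1, ← hx]
    simp [altCoeff]
    ring

/-- The same comparison with nome `q ^ 2`; the initial values are `thetaAlt (q ^ 3)`, `-thetaOct q`
and `-q * thetaOct q`. -/
lemma triCoeff_eq (n : ℤ) : triCoeff x (2 * thetaPent q) (x * thetaTri (q ^ 3)) n
    = 2 * qPoch (-q) q * thetaMul (q ^ 2) (triTerm q) n := by
  have hx0 : x ≠ 0 := fun h => hq0 (by rw [← hx, h]; ring)
  have hsq : ∀ n : ℤ, (q ^ 2) ^ n = q ^ (2 * n) := fun n => by rw [zpow_mul]; rfl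
  have halpha : ∀ n, alpha (q ^ 2) n = (-1) ^ n * q ^ (n ^ 2 - n) := fun n => by
    rw [alpha, hsq, two_mul_tri]
    ring_nf
  have hE := qPoch_odd_mul_qPoch_neg hq1
  have hT := qPoch_mul_thetaTri_cube hq0 hq1
  have hp1 : thetaMul (q ^ 2) (triTerm q) 1 = -thetaOct q := by
    rw [thetaMul_one, ← (Equiv.neg ℤ).tsum_eq, thetaOct]
    congr 1
    refine tsum_congr fun m => ?_
    simp only [Equiv.neg_apply, halpha, triTerm, neg_one_zpow_neg]
    rw [mul_assoc, ← zpow_add₀ hq0]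
    ring_nf
  refine eq_of_three_step (f := triCoeff x _ _) (g := fun n => 2 * qPoch (-q) q *
    thetaMul (q ^ 2) (triTerm q) n) (w := fun n => 1 * (q ^ 2) ^ (2 * n + 1 + 0) * q)
    (fun n => mul_ne_zero (mul_ne_zero one_ne_zero (zpow_ne_zero _ (pow_ne_zero 2 hq0))) hq0)
    (fun n => ?_) (fun n => ?_) ?_ ?_ ?_ n
  · rw [triCoeff, triCoeff, Int.add_emod_right, hsq, ← zpow_three_mul hx,
      show 2 * (n + 3) ^ 2 - 3 * (n + 3) = 3 * (2 * (2 * n + 1 + 0)) + 3 + (2 * n ^ 2 - 3 * n) by ring,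
      zpow_add₀ hx0 (3 * _ + 3), zpow_add₀ hx0 (3 * _), ← hx]
    norm_num [zpow_ofNat]
    ring_nf
  · rw [thetaMul_add_three (pow_ne_zero 2 hq0) (c := q) (d := 0) fun m => ?_]
    · ring
    · rw [triTerm, triTerm, hsq,
        show 2 * (m + 1) ^ 2 - (m + 1) = 1 + 2 * (2 * m + 0) + (2 * m ^ 2 - m) by ring,
        zpow_add₀ hq0 (1 + 2 * _), zpow_add₀ hq0 1, zpow_one]
  · have hp0 : thetaMul (q ^ 2) (triTerm q) 0 = thetaAlt (q ^ 3) := by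
      rw [thetaMul_zero, thetaAlt]
      refine tsum_congr fun m => ?_
      rw [halpha, triTerm, mul_assoc, ← zpow_add₀ hq0, ← zpow_three_mul rfl]
      ring_nf
    rw [hp0, thetaAlt_cube hq0 hq1]
    simp only [triCoeff]
    norm_num
    linear_combination -2 * thetaPent q * hE
  · rw [hp1]
    simp only [triCoeff]
    norm_num
    field_simp
    linear_combination qPoch (-q) q * hT - thetaTri (q ^ 3) * hE
  · have hp2 : thetaMul (q ^ 2) (triTerm q) 2 = -(q * thetaOct q) := by
      rw [thetaMul_two, thetaOct, ← tsum_mul_left]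
      congr 1
      refine tsum_congr fun m => ?_
      rw [halpha, triTerm, mul_assoc, ← zpow_add₀ hq0,
        show m ^ 2 - m + (2 * (m + 1) ^ 2 - (m + 1)) = 1 + (3 * m ^ 2 + 2 * m) by ring,
        zpow_add₀ hq0, zpow_one]
      ring
    rw [hp2, ← hx]
    rw [← hx] at hE hT
    simp only [triCoeff]
    norm_num [zpow_ofNat]
    linear_combination x ^ 3 * (qPoch (-x ^ 3) (x ^ 3) * hT - thetaTri ((x ^ 3) ^ 3) * hE)

end

lemma summable_norm_altTerm {q : ℂ} (hq0 : q ≠ 0) (hq1 : ‖q‖ < 1) :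
    Summable fun m => ‖altTerm q m‖ := summable_norm_thetaAlt hq0 hq1

lemma summable_norm_triTerm {q : ℂ} (hq0 : q ≠ 0) (hq1 : ‖q‖ < 1) :
    Summable fun m => ‖triTerm q m‖ :=
  summable_norm_zpow hq0 hq1 1 fun n => by
    rcases abs_cases n with h | h <;> nlinarith [sq_nonneg (n - 1), sq_nonneg n]

section
variable {x q : ℂ} (hq0 : q ≠ 0) (hq1 : ‖q‖ < 1) (hx : x ^ 3 = q)
include hq0 hq1 hx

lemma tsum_kern_mul_altCoeff (k : ℤ) :
    ∑' p : ℤ × ℤ, kern q p.1 p.2 *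
      (altCoeff x (thetaAlt (q ^ 3)) (-2 * x * thetaOct q) (p.1 + k) *
        altCoeff x (thetaAlt (q ^ 3)) (-2 * x * thetaOct q) (p.2 + k))
      = qPoch q (q ^ 2) ^ 2 * qPoch q q ^ 3 *
        ∑' m : ℤ, q ^ (2 * m ^ 2) * alpha q (m - k + 1) := by
  have h := tsum_kern_mul_thetaMul hq0 hq1 (summable_norm_altTerm hq0 hq1) k
  have h1 : ∀ m, altTerm q m ^ 2 = q ^ (2 * m ^ 2) := fun m => by
    rw [altTerm, mul_pow, sq ((-1 : ℂ) ^ m), neg_one_zpow_mul_self, one_mul, sq, ← zpow_add₀ hq0]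
    ring_nf
  simp only [h1] at h
  rw [mul_assoc (qPoch q (q ^ 2) ^ 2), ← h, ← tsum_mul_left]
  simp only [altCoeff_eq hq0 hq1 hx]
  exact tsum_congr fun p => by ring

lemma tsum_kern_mul_triCoeff (k : ℤ) :
    ∑' p : ℤ × ℤ, kern (q ^ 2) p.1 p.2 *
      (triCoeff x (2 * thetaPent q) (x * thetaTri (q ^ 3)) (p.1 + k) *
        triCoeff x (2 * thetaPent q) (x * thetaTri (q ^ 3)) (p.2 + k))
      = 4 * qPoch (-q) q ^ 2 * qPoch (q ^ 2) (q ^ 2) ^ 3 *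
        ∑' m : ℤ, q ^ (4 * m ^ 2 - 2 * m) * alpha (q ^ 2) (m - k + 1) := by
  have h := tsum_kern_mul_thetaMul (pow_ne_zero 2 hq0) (norm_pow_lt_one hq1 two_ne_zero)
    (summable_norm_triTerm hq0 hq1) k
  have h1 : ∀ m, triTerm q m ^ 2 = q ^ (4 * m ^ 2 - 2 * m) := fun m => by
    rw [triTerm, sq, ← zpow_add₀ hq0]
    ring_nf
  simp only [h1] at h
  rw [mul_assoc (4 * qPoch (-q) q ^ 2), ← h, ← tsum_mul_left]
  simp only [triCoeff_eq hq0 hq1 hx]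
  exact tsum_congr fun p => by ring

end

/-! ### The single series on the right-hand sides. -/

lemma two_mul_quint (n a : ℤ) (ha : Odd a) : 2 * ((5 * n ^ 2 + a * n) / 2) = 5 * n ^ 2 + a * n := by
  refine Int.mul_ediv_cancel' (Even.two_dvd ?_)
  have : Even (n * (n + 1)) := Int.even_mul_succ_self n
  obtain ⟨b, rfl⟩ := ha
  rw [show 5 * n ^ 2 + (2 * b + 1) * n = n * (n + 1) + 2 * (2 * n ^ 2 + b * n) by ring]
  exact this.add (even_two_mul _)

section
variable {q : ℂ} (hq0 : q ≠ 0)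
include hq0

lemma tsum_alpha_quint_one :
    ∑' m : ℤ, q ^ (2 * m ^ 2) * alpha q (m - 2 + 1)
      = -q * ∑' n : ℤ, (-1 : ℂ) ^ n * q ^ ((5 * n ^ 2 + 3 * n) / 2) := by
  rw [← (Equiv.neg ℤ).tsum_eq, ← tsum_mul_left]
  refine tsum_congr fun m => ?_
  have h1 := two_mul_quint m 3 (by decide)
  have h2 := two_mul_tri (-m - 2 + 1)
  rw [Equiv.neg_apply, alpha, mul_left_comm, ← zpow_add₀ hq0,
    show 2 * (-m) ^ 2 + (-m - 2 + 1) * (-m - 2 + 1 - 1) / 2 = 1 + (5 * m ^ 2 + 3 * m) / 2 by linarith,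
    show -m - 2 + 1 = -(m + 1) by ring, neg_one_zpow_neg, zpow_add₀ hq0, zpow_add₀ (by norm_num)]
  simp only [zpow_one]
  ring

lemma tsum_alpha_quint_two :
    ∑' m : ℤ, q ^ (2 * m ^ 2) * alpha q (m - 1 + 1)
      = ∑' n : ℤ, (-1 : ℂ) ^ n * q ^ ((5 * n ^ 2 + n) / 2) := by
  rw [← (Equiv.neg ℤ).tsum_eq]
  refine tsum_congr fun m => ?_
  have h1 := two_mul_quint m 1 (by decide)
  have h2 := two_mul_tri (-m)
  rw [one_mul] at h1
  rw [Equiv.neg_apply, sub_add_cancel, alpha, mul_left_comm, ← zpow_add₀ hq0, neg_one_zpow_neg]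
  congr 2
  linarith

lemma tsum_alpha_quint_three :
    ∑' m : ℤ, q ^ (4 * m ^ 2 - 2 * m) * alpha (q ^ 2) (m - 0 + 1)
      = -∑' n : ℤ, (-1 : ℂ) ^ n * q ^ (5 * n ^ 2 + n) := by
  rw [← (Equiv.neg ℤ).tsum_eq, ← tsum_neg]
  refine tsum_congr fun m => ?_
  rw [Equiv.neg_apply, alpha, mul_left_comm, ← zpow_natCast, ← zpow_mul, Nat.cast_ofNat,
    two_mul_tri, ← zpow_add₀ hq0, show -m - 0 + 1 = -(m - 1) by ring, neg_one_zpow_neg,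
    zpow_sub₀ (by norm_num)]
  ring_nf

lemma tsum_alpha_quint_four :
    ∑' m : ℤ, q ^ (4 * m ^ 2 - 2 * m) * alpha (q ^ 2) (m - 1 + 1)
      = ∑' n : ℤ, (-1 : ℂ) ^ n * q ^ (5 * n ^ 2 + 3 * n) := by
  rw [← (Equiv.neg ℤ).tsum_eq]
  refine tsum_congr fun m => ?_
  rw [Equiv.neg_apply, sub_add_cancel, alpha, mul_left_comm, ← zpow_natCast, ← zpow_mul,
    Nat.cast_ofNat, two_mul_tri, ← zpow_add₀ hq0, neg_one_zpow_neg]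
  ring_nf

end

/-! ### Sorting exponents by their residues modulo three -/

/-- The part of `∑ g i * x ^ e i` with exponents congruent to `j` modulo three. -/
def residuePart {ι : Type*} (g : ι → ℂ) (e : ι → ℤ) (x : ℂ) (j : ℤ) : ℂ :=
  ∑' i, if e i % 3 = j then g i * x ^ e i else 0

section
variable {ι : Type*} {g : ι → ℂ} {e : ι → ℤ} {x : ℂ}

lemma hasSum_residuePart (h : Summable fun i => ‖g i * x ^ e i‖) (j : ℤ) :
    HasSum (fun i => if e i % 3 = j then g i * x ^ e i else 0) (residuePart g e x j) := by
  refine Summable.hasSum (Summable.of_norm_bounded h fun i => ?_)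
  split_ifs
  · exact le_rfl
  · rw [norm_zero]
    exact norm_nonneg _

lemma tsum_root_mul {ω : ℂ} (hω : ω ^ 3 = 1) (h : Summable fun i => ‖g i * x ^ e i‖) :
    ∑' i, g i * (ω * x) ^ e i
      = residuePart g e x 0 + ω * residuePart g e x 1 + ω ^ 2 * residuePart g e x 2 := by
  have hω0 : ω ≠ 0 := fun h0 => by simp [h0] at hω
  rw [← (((hasSum_residuePart h 0).add ((hasSum_residuePart h 1).mul_left ω)).add
    ((hasSum_residuePart h 2).mul_left (ω ^ 2))).tsum_eq]
  refine tsum_congr fun i => ?_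
  have h1 : ω ^ e i = ω ^ (e i % 3) := by
    conv_lhs => rw [← Int.mul_ediv_add_emod (e i) 3]
    rw [zpow_add₀ hω0, zpow_three_mul hω, one_zpow, one_mul]
  have h2 : e i % 3 = 0 ∨ e i % 3 = 1 ∨ e i % 3 = 2 := by omega
  rw [mul_zpow, h1]
  rcases h2 with h2 | h2 | h2 <;> norm_num [h2, zpow_ofNat] <;> ring

end

/-- The number of indices satisfying `d` determines both the weight (`A²`, `-AB`, `B²`) and the
exponent mod 3, so the weighted sum is a quadratic form in `A`, `B` with residue parts as
coefficients. -/
lemma tsum_bilinear_residuePart {g : ℤ × ℤ → ℂ} {e : ℤ × ℤ → ℤ} {x : ℂ}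
    (h : Summable fun i => ‖g i * x ^ e i‖) {f : ℤ × ℤ → ℂ} {A B κ : ℂ} (d : ℤ → Prop)
    [DecidablePred d] {i j k : ℤ} (hij : i ≠ j) (hik : i ≠ k) (hjk : j ≠ k)
    (hf : ∀ p, f p = κ * ((if d p.1 then -B else A) * (if d p.2 then -B else A) *
      (g p * x ^ e p)))
    (he : ∀ p, e p % 3 = if d p.1 then (if d p.2 then k else j) else (if d p.2 then j else i)) :
    ∑' p, f p = κ * (A ^ 2 * residuePart g e x i - A * B * residuePart g e x j
      + B ^ 2 * residuePart g e x k) := by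
  rw [← (((((hasSum_residuePart h i).mul_left (A ^ 2)).sub
    ((hasSum_residuePart h j).mul_left (A * B))).add
    ((hasSum_residuePart h k).mul_left (B ^ 2))).mul_left κ).tsum_eq]
  refine tsum_congr fun p => ?_
  rw [hf, he]
  by_cases h1 : d p.1 <;> by_cases h2 : d p.2 <;>
    simp only [h1, h2, if_true, if_false, hij, hik, hjk, hij.symm, hik.symm, hjk.symm] <;> ring

lemma residuePart_eq_tsum {g : ℤ × ℤ → ℂ} {e : ℤ × ℤ → ℤ} {x : ℂ} {j a : ℤ} (b : ℤ) (ha : a ≠ 0)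
    (h1 : ∀ p, e p % 3 = j → ∃ r s, p = (a * r + b, a * s + b))
    (h2 : ∀ r s, e (a * r + b, a * s + b) % 3 = j) :
    residuePart g e x j
      = ∑' p : ℤ × ℤ, g (a * p.1 + b, a * p.2 + b) * x ^ e (a * p.1 + b, a * p.2 + b) := by
  have hinj : Function.Injective fun p : ℤ × ℤ => (a * p.1 + b, a * p.2 + b) := fun p p' h => by
    obtain ⟨h1, h2⟩ := Prod.mk.inj h
    exact Prod.ext (mul_left_cancel₀ ha (add_right_cancel h1))
      (mul_left_cancel₀ ha (add_right_cancel h2))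
  rw [residuePart, ← hinj.tsum_eq]
  · exact tsum_congr fun p => if_pos (h2 _ _)
  · intro p hp
    by_cases h : e p % 3 = j
    · obtain ⟨r, s, rfl⟩ := h1 p h
      exact ⟨(r, s), rfl⟩
    · exact absurd (if_neg h) hp

/-! ### The indefinite double sums -/

/-- The weights of the double sums in `φ` and `ψ`. -/
def altWeight (p : ℤ × ℤ) : ℂ := rho p.1 p.2 * (-1 : ℂ) ^ (p.1 + p.2)

/-- The weights of the double sums in `X` and `χ`. -/
def rhoWeight (p : ℤ × ℤ) : ℂ := rho p.1 p.2

/-- The exponents in `φ`. -/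
def phiExp (p : ℤ × ℤ) : ℤ := p.1 ^ 2 + 3 * p.1 * p.2 + p.2 ^ 2 + p.1 + p.2

/-- The exponents in `ψ`. -/
def psiExp (p : ℤ × ℤ) : ℤ := p.1 ^ 2 + 3 * p.1 * p.2 + p.2 ^ 2 + 3 * p.1 + 3 * p.2 + 2

/-- The exponents in `X`. -/
def bigXExp (p : ℤ × ℤ) : ℤ := 2 * p.1 ^ 2 + 6 * p.1 * p.2 + 2 * p.2 ^ 2 + p.1 + p.2

/-- The exponents in `χ`. -/
def chiExp (p : ℤ × ℤ) : ℤ := 2 * p.1 ^ 2 + 6 * p.1 * p.2 + 2 * p.2 ^ 2 - 3 * p.1 - 3 * p.2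

lemma phi_eq (q : ℂ) : phi q = (∑' p, altWeight p * q ^ phiExp p) / thetaAlt q := by
  rw [phi, one_div_mul_eq_div, indefSum]
  simp only [altWeight, phiExp, mul_assoc]

lemma psi_eq (q : ℂ) : psi q = -(∑' p, altWeight p * q ^ psiExp p) / thetaAlt q := by
  rw [psi, one_div_mul_eq_div, indefSum, ← tsum_neg]
  congr 1
  refine tsum_congr fun p => ?_
  rw [altWeight, psiExp, zpow_add₀ (by norm_num) (p.1 + p.2), zpow_one]
  ring

lemma bigX_eq (q : ℂ) : bigX q = 2 * (∑' p, rhoWeight p * q ^ bigXExp p) / thetaTri q := by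
  rw [bigX, div_mul_eq_mul_div, indefSum]
  simp only [rhoWeight, bigXExp]

lemma chi_eq (q : ℂ) :
    chi q = 2 - 2 * q * (∑' p, rhoWeight p * q ^ chiExp p) / thetaTri q := by
  rw [chi, div_mul_eq_mul_div, indefSum]
  simp only [rhoWeight, chiExp]

lemma norm_rho_le (r s : ℤ) : ‖(rho r s : ℂ)‖ ≤ 1 := by
  unfold rho
  split_ifs <;> simp

lemma mul_nonneg_of_rho_ne_zero {r s : ℤ} (h : (rho r s : ℂ) ≠ 0) : 0 ≤ r * s := by
  have h' : rho r s ≠ 0 := fun h0 => h (by simp [h0])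
  unfold rho at h'
  split_ifs at h' with h1 h2
  · exact mul_nonneg h1.1 h1.2
  · exact mul_nonneg_of_nonpos_of_nonpos h2.1.le h2.2.le
  · exact absurd rfl h'

/-- The quadratic forms are indefinite, but `rho` is supported where `r * s ≥ 0`, so growth of the
exponent is needed only there. -/
lemma summable_norm_weight {x : ℂ} (hx0 : x ≠ 0) (hx1 : ‖x‖ < 1) {g : ℤ × ℤ → ℂ}
    {e : ℤ × ℤ → ℤ} (hg : ∀ p, ‖g p‖ ≤ ‖(rho p.1 p.2 : ℂ)‖) (C : ℤ)
    (he : ∀ r s, 0 ≤ r * s → |r| + |s| ≤ e (r, s) + C) : Summable fun p => ‖g p * x ^ e p‖ := by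
  have h0 : 0 < ‖x‖ := norm_pos_iff.mpr hx0
  have hs := summable_pow_natAbs h0.le hx1
  refine Summable.of_nonneg_of_le (fun _ => norm_nonneg _) (fun ⟨r, s⟩ => ?_)
    ((hs.mul_of_nonneg hs (fun _ => pow_nonneg h0.le _) fun _ => pow_nonneg h0.le _).mul_left
      (‖x‖ ^ (-C)))
  by_cases h : (rho r s : ℂ) = 0
  · have : g (r, s) = 0 := by simpa [h] using hg (r, s)
    rw [this, zero_mul, norm_zero]
    positivity
  · rw [norm_mul, norm_zpow]
    refine (mul_le_of_le_one_left (zpow_nonneg h0.le _)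
      ((hg _).trans (norm_rho_le _ _))).trans ?_
    simp only
    rw [← zpow_natCast, ← zpow_natCast, Int.natCast_natAbs, Int.natCast_natAbs, ← zpow_add₀ h0.ne',
      ← zpow_add₀ h0.ne']
    exact zpow_le_zpow_right_of_le_one₀ h0 hx1.le
      (by linarith [he r s (mul_nonneg_of_rho_ne_zero h)])

lemma norm_altWeight_le (p : ℤ × ℤ) : ‖altWeight p‖ ≤ ‖(rho p.1 p.2 : ℂ)‖ := by
  rw [altWeight, norm_mul, norm_neg_one_zpow, mul_one]

section
variable {x : ℂ} (hx0 : x ≠ 0) (hx1 : ‖x‖ < 1)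
include hx0 hx1

lemma summable_phi : Summable fun p => ‖altWeight p * x ^ phiExp p‖ :=
  summable_norm_weight hx0 hx1 norm_altWeight_le 2 fun r s h => by
    unfold phiExp
    nlinarith [sq_abs r, sq_abs s, neg_abs_le r, neg_abs_le s, sq_nonneg (|r| - 1),
      sq_nonneg (|s| - 1)]

lemma summable_psi : Summable fun p => ‖altWeight p * x ^ psiExp p‖ :=
  summable_norm_weight hx0 hx1 norm_altWeight_le 8 fun r s h => by
    unfold psiExp
    nlinarith [sq_abs r, sq_abs s, neg_abs_le r, neg_abs_le s, sq_nonneg (|r| - 2),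
      sq_nonneg (|s| - 2)]

lemma summable_bigX : Summable fun p => ‖rhoWeight p * x ^ bigXExp p‖ :=
  summable_norm_weight hx0 hx1 (fun _ => le_rfl) 2 fun r s h => by
    unfold bigXExp
    nlinarith [sq_abs r, sq_abs s, neg_abs_le r, neg_abs_le s, sq_nonneg (|r| - 1),
      sq_nonneg (|s| - 1)]

lemma summable_chi : Summable fun p => ‖rhoWeight p * x ^ chiExp p‖ :=
  summable_norm_weight hx0 hx1 (fun _ => le_rfl) 4 fun r s h => by
    unfold chiExp
    nlinarith [sq_abs r, sq_abs s, le_abs_self r, le_abs_self s, sq_nonneg (|r| - 1),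
      sq_nonneg (|s| - 1)]

end

/-! ### Residues of the exponents -/

lemma emod_three_cases (r : ℤ) : ∃ k, r = 3 * k ∨ r = 3 * k + 1 ∨ r = 3 * k + 2 := ⟨r / 3, by omega⟩

lemma phiExp_emod (p : ℤ × ℤ) : phiExp p % 3 =
    if (p.1 + 1) % 3 = 2 then (if (p.2 + 1) % 3 = 2 then 1 else 2)
    else (if (p.2 + 1) % 3 = 2 then 2 else 0) := by
  obtain ⟨r, s⟩ := p
  obtain ⟨k, rfl | rfl | rfl⟩ := emod_three_cases r <;>
  obtain ⟨l, rfl | rfl | rfl⟩ := emod_three_cases s <;>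
  · simp only [phiExp]
    ring_nf
    split_ifs <;> omega

lemma psiExp_emod (p : ℤ × ℤ) : psiExp p % 3 =
    if (p.1 + 2) % 3 = 2 then (if (p.2 + 2) % 3 = 2 then 2 else 0)
    else (if (p.2 + 2) % 3 = 2 then 0 else 1) := by
  obtain ⟨r, s⟩ := p
  obtain ⟨k, rfl | rfl | rfl⟩ := emod_three_cases r <;>
  obtain ⟨l, rfl | rfl | rfl⟩ := emod_three_cases s <;>
  · simp only [psiExp]
    ring_nf
    split_ifs <;> omega

lemma bigXExp_emod (p : ℤ × ℤ) : bigXExp p % 3 =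
    if (p.1 + 1) % 3 ≠ 0 then (if (p.2 + 1) % 3 ≠ 0 then 0 else 1)
    else (if (p.2 + 1) % 3 ≠ 0 then 1 else 2) := by
  obtain ⟨r, s⟩ := p
  obtain ⟨k, rfl | rfl | rfl⟩ := emod_three_cases r <;>
  obtain ⟨l, rfl | rfl | rfl⟩ := emod_three_cases s <;>
  · simp only [bigXExp]
    ring_nf
    split_ifs <;> omega

lemma chiExp_emod (p : ℤ × ℤ) : chiExp p % 3 =
    if (p.1 + 0) % 3 ≠ 0 then (if (p.2 + 0) % 3 ≠ 0 then 1 else 2)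
    else (if (p.2 + 0) % 3 ≠ 0 then 2 else 0) := by
  obtain ⟨r, s⟩ := p
  obtain ⟨k, rfl | rfl | rfl⟩ := emod_three_cases r <;>
  obtain ⟨l, rfl | rfl | rfl⟩ := emod_three_cases s <;>
  · simp only [chiExp]
    ring_nf
    split_ifs <;> omega

/-! ### Bilinear relations between the residue parts -/

section
variable {x q : ℂ} (hq0 : q ≠ 0) (hq1 : ‖q‖ < 1) (hx : x ^ 3 = q)
include hq0 hq1 hx

lemma bilinear_phi {A B : ℂ} (hA : A = thetaAlt (q ^ 3)) (hB : B = -2 * x * thetaOct q) :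
    A ^ 2 * residuePart altWeight phiExp x 0 - A * B * residuePart altWeight phiExp x 2
        + B ^ 2 * residuePart altWeight phiExp x 1
      = qPoch q (q ^ 2) ^ 2 * qPoch q q ^ 3 *
        ∑' n : ℤ, (-1 : ℂ) ^ n * q ^ ((5 * n ^ 2 + n) / 2) := by
  have hx0 : x ≠ 0 := fun h => hq0 (by rw [← hx, h]; ring)
  -- The shift 1 fits since `(r + 1)² - (r + 1) = r² + r`.
  have h := tsum_kern_mul_altCoeff hq0 hq1 hx 1
  rw [← hA, ← hB, tsum_alpha_quint_two hq0, tsum_bilinear_residuePart (κ := 1) (A := A) (B := B)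
    (summable_phi hx0 (norm_lt_one_of_cube hq1 hx)) (fun r => (r + 1) % 3 = 2)
    (by decide) (by decide) (by decide) (fun p => ?_) phiExp_emod, one_mul] at h
  · exact h
  · simp only [kern, altCoeff, altWeight]
    rw [← zpow_three_mul hx, show phiExp p = 3 * (p.1 * p.2) + ((p.1 + 1) ^ 2 - (p.1 + 1))
      + ((p.2 + 1) ^ 2 - (p.2 + 1)) by unfold phiExp; ring, zpow_add₀ hx0, zpow_add₀ hx0,
      zpow_add₀ (by norm_num) p.1 1, zpow_add₀ (by norm_num) p.2 1, zpow_add₀ (by norm_num) p.1 p.2]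
    simp only [zpow_one]
    ring

lemma bilinear_psi {A B : ℂ} (hA : A = thetaAlt (q ^ 3)) (hB : B = -2 * x * thetaOct q) :
    A ^ 2 * residuePart altWeight psiExp x 1 - A * B * residuePart altWeight psiExp x 0
        + B ^ 2 * residuePart altWeight psiExp x 2
      = -x * (qPoch q (q ^ 2) ^ 2 * qPoch q q ^ 3 *
        ∑' n : ℤ, (-1 : ℂ) ^ n * q ^ ((5 * n ^ 2 + 3 * n) / 2)) := by
  have hx0 : x ≠ 0 := fun h => hq0 (by rw [← hx, h]; ring)
  -- With shift 2 each coefficient contributes a constant 2 to the exponent, while `psiExp` has 2 in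
  -- all; hence `κ = x ^ 2`.
  have h := tsum_kern_mul_altCoeff hq0 hq1 hx 2
  rw [← hA, ← hB, tsum_alpha_quint_one hq0, tsum_bilinear_residuePart (κ := x ^ 2) (A := A) (B := B)
    (summable_psi hx0 (norm_lt_one_of_cube hq1 hx)) (fun r => (r + 2) % 3 = 2)
    (by decide) (by decide) (by decide) (fun p => ?_) psiExp_emod] at h
  · apply mul_left_cancel₀ (pow_ne_zero 2 hx0)
    rw [h, ← hx]
    ring
  · simp only [kern, altCoeff, altWeight]
    have e2 : (p.1 + 2) ^ 2 - (p.1 + 2) = 2 + (p.1 ^ 2 + 3 * p.1) := by ring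
    rw [e2, ← zpow_three_mul hx, show psiExp p = 3 * (p.1 * p.2) + (p.1 ^ 2 + 3 * p.1)
      + ((p.2 + 2) ^ 2 - (p.2 + 2)) by unfold psiExp; ring, zpow_add₀ hx0 2,
      zpow_add₀ hx0 (3 * (p.1 * p.2) + _), zpow_add₀ hx0 (3 * (p.1 * p.2)),
      zpow_add₀ (by norm_num) p.1 2, zpow_add₀ (by norm_num) p.2 2,
      zpow_add₀ (by norm_num) p.1 p.2]
    norm_num [zpow_ofNat]
    ring_nf

lemma bilinear_chi {A B : ℂ} (hA : A = 2 * thetaPent q) (hB : B = x * thetaTri (q ^ 3)) :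
    A ^ 2 * residuePart rhoWeight chiExp x 0 - A * B * residuePart rhoWeight chiExp x 2
        + B ^ 2 * residuePart rhoWeight chiExp x 1
      = -(4 * qPoch (-q) q ^ 2 * qPoch (q ^ 2) (q ^ 2) ^ 3 *
        ∑' n : ℤ, (-1 : ℂ) ^ n * q ^ (5 * n ^ 2 + n)) := by
  have hx0 : x ≠ 0 := fun h => hq0 (by rw [← hx, h]; ring)
  have h := tsum_kern_mul_triCoeff hq0 hq1 hx 0
  rw [← hA, ← hB, tsum_alpha_quint_three hq0, tsum_bilinear_residuePart (κ := 1) (A := A) (B := B)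
    (summable_chi hx0 (norm_lt_one_of_cube hq1 hx)) (fun r => (r + 0) % 3 ≠ 0)
    (by decide) (by decide) (by decide) (fun p => ?_) chiExp_emod, one_mul] at h
  · rw [h, mul_neg]
  · simp only [kern, triCoeff, rhoWeight, ite_not, add_zero]
    rw [← zpow_natCast, ← zpow_mul, ← zpow_three_mul hx, show chiExp p =
      3 * ((2 : ℕ) * (p.1 * p.2)) + (2 * p.1 ^ 2 - 3 * p.1) + (2 * p.2 ^ 2 - 3 * p.2) by
        unfold chiExp; push_cast; ring, zpow_add₀ hx0, zpow_add₀ hx0]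
    ring

lemma bilinear_bigX {A B : ℂ} (hA : A = 2 * thetaPent q) (hB : B = x * thetaTri (q ^ 3)) :
    A ^ 2 * residuePart rhoWeight bigXExp x 2 - A * B * residuePart rhoWeight bigXExp x 1
        + B ^ 2 * residuePart rhoWeight bigXExp x 0
      = x ^ 2 * (4 * qPoch (-q) q ^ 2 * qPoch (q ^ 2) (q ^ 2) ^ 3 *
        ∑' n : ℤ, (-1 : ℂ) ^ n * q ^ (5 * n ^ 2 + 3 * n)) := by
  have hx0 : x ≠ 0 := fun h => hq0 (by rw [← hx, h]; ring)
  -- Here `2(r + 1)² - 3(r + 1) = 2r² + r - 1`, so the two coefficients bring the surplus `x ^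
  -- (-2)`.
  have h := tsum_kern_mul_triCoeff hq0 hq1 hx 1
  rw [← hA, ← hB, tsum_alpha_quint_four hq0, tsum_bilinear_residuePart (κ := (x ^ 2)⁻¹) (A := A)
    (B := B) (summable_bigX hx0 (norm_lt_one_of_cube hq1 hx)) (fun r => (r + 1) % 3 ≠ 0)
    (by decide) (by decide) (by decide) (fun p => ?_) bigXExp_emod] at h
  · rw [← h, mul_inv_cancel_left₀ (pow_ne_zero 2 hx0)]
  · simp only [kern, triCoeff, rhoWeight, ite_not]
    have e1 : ∀ r : ℤ, 2 * (r + 1) ^ 2 - 3 * (r + 1) = 2 * r ^ 2 + r - 1 := fun r => by ring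
    rw [e1, e1, ← zpow_natCast q, ← zpow_mul, ← zpow_three_mul hx, show bigXExp p =
      3 * ((2 : ℕ) * (p.1 * p.2)) + (2 * p.1 ^ 2 + p.1) + (2 * p.2 ^ 2 + p.2) by
        unfold bigXExp; push_cast; ring, zpow_add₀ hx0, zpow_add₀ hx0, zpow_sub₀ hx0,
      zpow_sub₀ hx0, zpow_one]
    field_simp

end

/-! ### Identification of the remaining residue parts -/

lemma zpow_nine_mul {x q : ℂ} (hx : x ^ 3 = q) (e : ℤ) : (q ^ 3) ^ e = x ^ (9 * e) := by
  rw [show 9 * e = 3 * (3 * e) by ring, zpow_three_mul hx, zpow_three_mul rfl]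

lemma neg_one_zpow_congr {m n : ℤ} (h : (m - n) % 2 = 0) : (-1 : ℂ) ^ m = (-1) ^ n := by
  obtain ⟨k, hk⟩ := Int.dvd_of_emod_eq_zero h
  rw [show m = n + 2 * k by omega, zpow_add₀ (by norm_num), zpow_mul]
  norm_num

/-- Residue 1 forces both indices to be 1 mod 3. The substitution `r ↦ -3r - 2` exchanges
nonnegative and negative indices, so it flips `rho`, and it turns the exponent of `φ` into nine
times that of `ψ`, less 2. -/
lemma residuePart_phi {x q : ℂ} (hx0 : x ≠ 0) (hx : x ^ 3 = q) :
    residuePart altWeight phiExp x 1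
      = -(x ^ (-2 : ℤ) * ∑' p, altWeight p * (q ^ 3) ^ psiExp p) := by
  rw [residuePart_eq_tsum (a := -3) (-2) (by norm_num) (fun p hp => ?_) fun r s => ?_,
    ← tsum_mul_left, ← tsum_neg]
  · refine tsum_congr fun p => ?_
    have h1 : rho (-3 * p.1 + -2) (-3 * p.2 + -2) = -rho p.1 p.2 := by
      unfold rho
      split_ifs <;> omega
    rw [altWeight, altWeight, h1, zpow_nine_mul hx, show phiExp (-3 * p.1 + -2, -3 * p.2 + -2)
      = -2 + 9 * psiExp p by unfold phiExp psiExp; ring, zpow_add₀ hx0,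
      neg_one_zpow_congr (m := -3 * p.1 + -2 + (-3 * p.2 + -2)) (n := p.1 + p.2) (by omega)]
    push_cast
    ring
  · rw [phiExp_emod] at hp
    refine ⟨-(p.1 + 2) / 3, -(p.2 + 2) / 3, ?_⟩
    ext <;> simp only <;> split_ifs at hp <;> omega
  · rw [phiExp_emod]
    split_ifs <;> omega

lemma residuePart_psi {x q : ℂ} (hx0 : x ≠ 0) (hx : x ^ 3 = q) :
    residuePart altWeight psiExp x 2 = x ^ 2 * ∑' p, altWeight p * (q ^ 3) ^ phiExp p := by
  rw [residuePart_eq_tsum (a := 3) 0 (by norm_num) (fun p hp => ?_) fun r s => ?_,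
    ← tsum_mul_left]
  · refine tsum_congr fun p => ?_
    have h1 : rho (3 * p.1 + 0) (3 * p.2 + 0) = rho p.1 p.2 := by
      unfold rho
      split_ifs <;> omega
    rw [altWeight, altWeight, h1, zpow_nine_mul hx, show psiExp (3 * p.1 + 0, 3 * p.2 + 0)
      = 2 + 9 * phiExp p by unfold phiExp psiExp; ring, zpow_add₀ hx0,
      neg_one_zpow_congr (m := 3 * p.1 + 0 + (3 * p.2 + 0)) (n := p.1 + p.2) (by omega),
      zpow_ofNat]
    ring
  · rw [psiExp_emod] at hp
    refine ⟨p.1 / 3, p.2 / 3, ?_⟩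
    ext <;> simp only <;> split_ifs at hp <;> omega
  · rw [psiExp_emod]
    split_ifs <;> omega

/-- Negating both indices flips `rho` except on the two axes, whose indicators are the correction.
These axis sums become the theta function that cancels or supplies the constant 2 in `χ`. -/
lemma tsum_rhoWeight_neg {f : ℤ × ℤ → ℂ} (h : Summable fun p => rhoWeight p * f p)
    (h1 : Summable fun n => f (n, 0)) (h2 : Summable fun n => f (0, n)) :
    ∑' p, rhoWeight (-p) * f p
      = -∑' p, rhoWeight p * f p + ∑' n, f (n, 0) + ∑' n, f (0, n) := by
  have i1 : Function.Injective fun n : ℤ => (n, (0 : ℤ)) := fun a b h => (Prod.mk.inj h).1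
  have i2 : Function.Injective fun n : ℤ => ((0 : ℤ), n) := fun a b h => (Prod.mk.inj h).2
  have s1 : HasSum (fun p : ℤ × ℤ => if p.2 = 0 then f p else 0) (∑' n, f (n, 0)) := by
    rw [← i1.hasSum_iff]
    · simpa [Function.comp_def] using h1.hasSum
    · rintro ⟨r, s⟩ hs
      exact if_neg fun h0 => hs ⟨r, by simp [h0.symm]⟩
  have s2 : HasSum (fun p : ℤ × ℤ => if p.1 = 0 then f p else 0) (∑' n, f (0, n)) := by
    rw [← i2.hasSum_iff]
    · simpa [Function.comp_def] using h2.hasSum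
    · rintro ⟨r, s⟩ hs
      exact if_neg fun h0 => hs ⟨s, by simp [h0.symm]⟩
  rw [← ((h.hasSum.neg.add s1).add s2).tsum_eq]
  refine tsum_congr fun ⟨r, s⟩ => ?_
  have hr : rho (-r) (-s) = -rho r s + (if s = 0 then 1 else 0) + if r = 0 then 1 else 0 := by
    unfold rho
    split_ifs <;> omega
  simp only [rhoWeight, Prod.fst_neg, Prod.snd_neg, hr]
  push_cast
  split_ifs <;> ring

lemma thetaTri_bisection {y : ℂ} (hy0 : y ≠ 0) (hy1 : ‖y‖ < 1) :
    thetaTri y = 2 * ∑' n : ℤ, y ^ (2 * n ^ 2 + n) := by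
  have h1 := (summable_norm_thetaTri hy0 hy1).of_norm.hasSum
  rw [← (Int.divModEquiv 2).symm.hasSum_iff, ← (Equiv.prodComm (Fin 2) ℤ).hasSum_iff] at h1
  have h2 := h1.prod_fiberwise fun i => (h1.summable.prod_factor i).hasSum
  rw [thetaTri, (h2.unique (hasSum_fintype _)), Fin.sum_univ_two, two_mul]
  congr 1
  · refine tsum_congr fun n => ?_
    have := two_mul_tri' (n * 2)
    simp only [Int.divModEquiv, Function.comp]
    norm_num
    congr 1
    linarith
  · rw [← (Equiv.subLeft (-1 : ℤ)).tsum_eq]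
    refine tsum_congr fun n => ?_
    have := two_mul_tri' ((-1 - n) * 2 + 1)
    simp only [Int.divModEquiv, Function.comp]
    norm_num
    congr 1
    linarith

section
variable {y : ℂ} (hy0 : y ≠ 0) (hy1 : ‖y‖ < 1)
include hy0 hy1

lemma tsum_rhoWeight_neg_bigX :
    ∑' p, rhoWeight (-p) * y ^ bigXExp p
      = thetaTri y - ∑' p, rhoWeight p * y ^ bigXExp p := by
  have h : Summable fun n : ℤ => y ^ (2 * n ^ 2 + n) :=
    (summable_norm_zpow hy0 hy1 1 fun n => by
      rcases abs_cases n with h | h <;> nlinarith [sq_nonneg (n + 1), sq_nonneg n]).of_norm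
  rw [tsum_rhoWeight_neg (summable_bigX hy0 hy1).of_norm (by simpa [bigXExp] using h)
    (by simpa [bigXExp] using h), thetaTri_bisection hy0 hy1]
  simp [bigXExp]
  ring

lemma tsum_rhoWeight_neg_chi :
    y * ∑' p, rhoWeight p * y ^ chiExp p
      = thetaTri y - y * ∑' p, rhoWeight p * y ^ chiExp (-p) := by
  have h : Summable fun n : ℤ => y ^ (2 * n ^ 2 - 3 * n) :=
    (summable_norm_zpow hy0 hy1 2 fun n => by
      rcases abs_cases n with h | h <;> nlinarith [sq_nonneg (n - 1), sq_nonneg n]).of_norm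
  have h1 := tsum_rhoWeight_neg (summable_chi hy0 hy1).of_norm (by simpa [chiExp] using h)
    (by simpa [chiExp] using h)
  have h2 : ∑' p, rhoWeight (-p) * y ^ chiExp p = ∑' p, rhoWeight p * y ^ chiExp (-p) := by
    rw [← (Equiv.neg (ℤ × ℤ)).tsum_eq]
    simp
  have h3 : thetaTri y = 2 * (y * ∑' n : ℤ, y ^ (2 * n ^ 2 - 3 * n)) := by
    rw [thetaTri_bisection hy0 hy1]
    congr 1
    rw [← (Equiv.subRight (1 : ℤ)).tsum_eq fun n : ℤ => y ^ (2 * n ^ 2 + n), ← tsum_mul_left]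
    refine tsum_congr fun n => ?_
    rw [← zpow_one_add₀ hy0, Equiv.subRight_apply]
    ring_nf
  rw [h2] at h1
  rw [h1, h3]
  simp [chiExp]
  ring

end

lemma residuePart_chi {x q : ℂ} (hq0 : q ≠ 0) (hq1 : ‖q‖ < 1) (hx : x ^ 3 = q) :
    residuePart rhoWeight chiExp x 0
      = thetaTri (q ^ 3) - ∑' p, rhoWeight p * (q ^ 3) ^ bigXExp p := by
  rw [residuePart_eq_tsum (a := -3) 0 (by norm_num) (fun p hp => ?_) fun r s => ?_,
    ← tsum_rhoWeight_neg_bigX (pow_ne_zero 3 hq0) (norm_pow_lt_one hq1 three_ne_zero)]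
  · refine tsum_congr fun p => ?_
    have h1 : rho (-3 * p.1 + 0) (-3 * p.2 + 0) = rho (-p.1) (-p.2) := by
      unfold rho
      split_ifs <;> omega
    rw [rhoWeight, rhoWeight, h1, zpow_nine_mul hx, show chiExp (-3 * p.1 + 0, -3 * p.2 + 0)
      = 9 * bigXExp p by unfold chiExp bigXExp; ring, Prod.fst_neg, Prod.snd_neg]
  · rw [chiExp_emod] at hp
    refine ⟨-(p.1 / 3), -(p.2 / 3), ?_⟩
    ext <;> simp only <;> split_ifs at hp <;> omega
  · rw [chiExp_emod]
    split_ifs <;> omega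

lemma residuePart_bigX {x q : ℂ} (hq0 : q ≠ 0) (hq1 : ‖q‖ < 1) (hx : x ^ 3 = q) :
    q ^ 3 * ∑' p, rhoWeight p * (q ^ 3) ^ chiExp p
      = thetaTri (q ^ 3) + x * residuePart rhoWeight bigXExp x 2 := by
  have hx0 : x ≠ 0 := fun h => hq0 (by rw [← hx, h]; ring)
  have hq : q ^ 3 = x * x ^ 8 := by rw [← hx]; ring
  rw [residuePart_eq_tsum (a := -3) (-1) (by norm_num) (fun p hp => ?_) fun r s => ?_,
    tsum_rhoWeight_neg_chi (pow_ne_zero 3 hq0) (norm_pow_lt_one hq1 three_ne_zero), sub_eq_add_neg]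
  · nth_rewrite 2 [hq]
    rw [mul_assoc, ← mul_neg, ← tsum_mul_left, ← tsum_neg]
    congr 2
    refine tsum_congr fun p => ?_
    have h1 : rho (-3 * p.1 + -1) (-3 * p.2 + -1) = -rho p.1 p.2 := by
      unfold rho
      split_ifs <;> omega
    rw [rhoWeight, rhoWeight, h1, zpow_nine_mul hx, show bigXExp (-3 * p.1 + -1, -3 * p.2 + -1)
      = 8 + 9 * chiExp (-p) by simp only [chiExp, bigXExp, Prod.fst_neg, Prod.snd_neg]; ring,
      zpow_add₀ hx0, zpow_ofNat]
    push_cast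
    ring
  · rw [bigXExp_emod] at hp
    refine ⟨-(p.1 + 1) / 3, -(p.2 + 1) / 3, ?_⟩
    ext <;> simp only <;> split_ifs at hp <;> omega
  · rw [bigXExp_emod]
    split_ifs <;> omega

/-! ### Proof of the identities -/

section
variable {ω A B P₀ P₁ P₂ : ℂ} (hω : IsPrimitiveRoot ω 3)
include hω

lemma root_sub_sq_ne_zero : ω - ω ^ 2 ≠ 0 := fun h => by
  have h0 := hω.ne_zero three_ne_zero
  have h1 : ω * (1 - ω) = 0 := by linear_combination h
  exact hω.ne_one (by norm_num)
    (sub_eq_zero.mp ((mul_eq_zero.mp h1).resolve_left h0)).symm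

lemma root_norm_form : (A + ω * B) * (A + ω ^ 2 * B) = A ^ 2 - A * B + B ^ 2 := by
  linear_combination A * B * one_add_add_sq hω + B ^ 2 * hω.pow_eq_one

lemma root_quotient_sub (h1 : A + ω * B ≠ 0) (h2 : A + ω ^ 2 * B ≠ 0) :
    ((P₀ + ω * P₁ + ω ^ 2 * P₂) / (A + ω * B) - (P₀ + ω ^ 2 * P₁ + ω * P₂) / (A + ω ^ 2 * B))
        / (ω - ω ^ 2)
      = (A * (P₁ - P₂) + B * (P₂ - P₀)) / ((A + ω * B) * (A + ω ^ 2 * B)) := by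
  have h3 := root_sub_sq_ne_zero hω
  rw [div_sub_div _ _ h1 h2, div_div, div_eq_div_iff (by positivity) (by positivity)]
  linear_combination (A + ω * B) * (A + ω ^ 2 * B) * B * P₂ * ω * hω.pow_eq_one

/-- Replacing `P₂ / A` by `P₂ (A² - AB + B²)` over the common denominator cancels the stray `P₂`
terms and leaves the quadratic form of the bilinear relations. `root_combination_right` does this
with `P₂ / B`, for the functions whose value at `q ^ 3` has denominator proportional to `B`. -/
lemma root_combination_left (hA : A ≠ 0) (h1 : A + ω * B ≠ 0) (h2 : A + ω ^ 2 * B ≠ 0) :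
    P₂ / A + ((P₀ + ω * P₁ + ω ^ 2 * P₂) / (A + ω * B)
        - (P₀ + ω ^ 2 * P₁ + ω * P₂) / (A + ω ^ 2 * B)) / (ω - ω ^ 2)
      = (A ^ 2 * P₁ - A * B * P₀ + B ^ 2 * P₂) / (A * ((A + ω * B) * (A + ω ^ 2 * B))) := by
  have h3 := mul_ne_zero h1 h2
  rw [root_quotient_sub hω h1 h2]
  have hD := root_norm_form (A := A) (B := B) hω
  generalize (A + ω * B) * (A + ω ^ 2 * B) = D at *
  field_simp
  linear_combination P₂ * hD

lemma root_combination_right (hB : B ≠ 0) (h1 : A + ω * B ≠ 0) (h2 : A + ω ^ 2 * B ≠ 0) :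
    -(P₂ / B) + ((P₀ + ω * P₁ + ω ^ 2 * P₂) / (A + ω * B)
        - (P₀ + ω ^ 2 * P₁ + ω * P₂) / (A + ω ^ 2 * B)) / (ω - ω ^ 2)
      = -(A ^ 2 * P₂ - A * B * P₁ + B ^ 2 * P₀) / (B * ((A + ω * B) * (A + ω ^ 2 * B))) := by
  have h3 := mul_ne_zero h1 h2
  rw [root_quotient_sub hω h1 h2]
  have hD := root_norm_form (A := A) (B := B) hω
  generalize (A + ω * B) * (A + ω ^ 2 * B) = D at *
  field_simp
  linear_combination -P₂ * hD

end

/-! ### Assembly of the four identities. -/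

section
variable {q x ω : ℂ} (hq0 : q ≠ 0) (hq1 : ‖q‖ < 1) (hx : x ^ 3 = q) (hω : IsPrimitiveRoot ω 3)
include hq0 hq1 hx hω

lemma thetaAlt_data : ∃ A B : ℂ, A = thetaAlt (q ^ 3) ∧ B = -2 * x * thetaOct q ∧ A ≠ 0 ∧
    thetaAlt x = A + B ∧ thetaAlt (ω * x) = A + ω * B ∧ thetaAlt (ω ^ 2 * x) = A + ω ^ 2 * B ∧
    A + ω * B ≠ 0 ∧ A + ω ^ 2 * B ≠ 0 ∧
    (A + B) * (A * ((A + ω * B) * (A + ω ^ 2 * B))) = (qPoch q q * qPoch q (q ^ 2)) ^ 4 := by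
  have h3 := hω.pow_eq_one
  have hc := thetaAlt_cube_product hq1 hx hω hq0
  have e0 := thetaAlt_trisection hq0 hq1 hx
  have e1 := thetaAlt_trisection (y := ω * x) hq0 hq1 (by rw [mul_pow, h3, hx, one_mul])
  have e2 := thetaAlt_trisection (y := ω ^ 2 * x) hq0 hq1 (by
    rw [mul_pow, ← pow_mul, mul_comm 2 3, pow_mul, h3, hx, one_pow, one_mul])
  have hne := pow_ne_zero 4 (thetaAlt_ne_zero hq0 hq1)
  rw [← hc] at hne
  simp only [mul_ne_zero_iff] at hne
  obtain ⟨⟨⟨-, n1⟩, n2⟩, n3⟩ := hne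
  have f1 : thetaAlt (ω * x) = thetaAlt (q ^ 3) + ω * (-2 * x * thetaOct q) := by rw [e1]; ring
  have f2 : thetaAlt (ω ^ 2 * x) = thetaAlt (q ^ 3) + ω ^ 2 * (-2 * x * thetaOct q) := by
    rw [e2]; ring
  have f0 : thetaAlt x = thetaAlt (q ^ 3) + -2 * x * thetaOct q := by rw [e0]; ring
  refine ⟨_, _, rfl, rfl, n3, f0, f1, f2, f1 ▸ n1, f2 ▸ n2, ?_⟩
  rw [← f0, ← f1, ← f2, ← thetaAlt_eq hq0 hq1, ← hc]
  ring

lemma thetaTri_data : ∃ A B : ℂ, A = 2 * thetaPent q ∧ B = x * thetaTri (q ^ 3) ∧ B ≠ 0 ∧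
    thetaTri x = A + B ∧ thetaTri (ω * x) = A + ω * B ∧ thetaTri (ω ^ 2 * x) = A + ω ^ 2 * B ∧
    A + ω * B ≠ 0 ∧ A + ω ^ 2 * B ≠ 0 ∧
    (A + B) * (B * ((A + ω * B) * (A + ω ^ 2 * B))) = x * thetaTri q ^ 4 := by
  have hx0 : x ≠ 0 := fun h => hq0 (by rw [← hx, h]; ring)
  have h3 := hω.pow_eq_one
  have hc := thetaTri_cube_product hq1 hx hω hq0
  have e0 := thetaTri_trisection hq0 hq1 hx
  have e1 := thetaTri_trisection (y := ω * x) hq0 hq1 (by rw [mul_pow, h3, hx, one_mul])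
  have e2 := thetaTri_trisection (y := ω ^ 2 * x) hq0 hq1 (by
    rw [mul_pow, ← pow_mul, mul_comm 2 3, pow_mul, h3, hx, one_pow, one_mul])
  have hne := pow_ne_zero 4 (thetaTri_ne_zero hq0 hq1)
  rw [← hc] at hne
  simp only [mul_ne_zero_iff] at hne
  obtain ⟨⟨⟨-, n1⟩, n2⟩, n3⟩ := hne
  rw [mul_assoc] at e1 e2
  refine ⟨_, _, rfl, rfl, mul_ne_zero hx0 n3, e0, e1, e2, e1 ▸ n1, e2 ▸ n2, ?_⟩
  rw [← e0, ← e1, ← e2, ← hc]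
  ring

lemma root_mul_data : x ≠ 0 ∧ ‖x‖ < 1 ∧ (ω ^ 2) ^ 3 = 1 ∧ (ω ^ 2) ^ 2 = ω := by
  have h3 := hω.pow_eq_one
  refine ⟨fun h => hq0 (by rw [← hx, h]; ring), norm_lt_one_of_cube hq1 hx, ?_, ?_⟩
  · linear_combination (ω ^ 3 + 1) * h3
  · linear_combination ω * h3

theorem psi_identity :
    x ^ 2 * phi (q ^ 3) - (psi (ω * x) - psi (ω ^ 2 * x)) / (ω - ω ^ 2)
      = -x * (thetaAlt x / thetaAlt q) *
        ((∑' n : ℤ, (-1 : ℂ) ^ n * q ^ ((5 * n ^ 2 + 3 * n) / 2)) / qPoch q (q ^ 2)) := by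
  obtain ⟨hx0, hx1, hs3, hs2⟩ := root_mul_data hq0 hq1 hx hω
  obtain ⟨A, B, hA, hB, hA0, f0, f1, f2, n1, n2, hprod⟩ := thetaAlt_data hq0 hq1 hx hω
  have s := summable_psi hx0 hx1
  have hE := qPoch_self_ne_zero hq1
  have hh : qPoch q (q ^ 2) ≠ 0 := qPoch_ne_zero_of_norm_lt (norm_pow_lt_one hq1 two_ne_zero) hq1
  have hD := mul_ne_zero hA0 (mul_ne_zero n1 n2)
  have hcomb := root_combination_left (P₀ := residuePart altWeight psiExp x 0)
    (P₁ := residuePart altWeight psiExp x 1) (P₂ := residuePart altWeight psiExp x 2) hω hA0 n1 n2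
  rw [bilinear_psi hq0 hq1 hx hA hB] at hcomb
  have hphi : x ^ 2 * phi (q ^ 3) = residuePart altWeight psiExp x 2 / A := by
    rw [phi_eq, residuePart_psi hx0 hx, ← hA, mul_div_assoc]
  rw [hphi, psi_eq, psi_eq, tsum_root_mul hω.pow_eq_one s, tsum_root_mul hs3 s, hs2, f1, f2, f0,
    thetaAlt_eq hq0 hq1, show ∀ a b c d e f : ℂ, c - (-a / b - -d / e) / f = c + (a / b - d / e) / f
      from fun a b c d e f => by ring, hcomb]
  generalize A * ((A + ω * B) * (A + ω ^ 2 * B)) = D at hprod hD ⊢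
  generalize (∑' n : ℤ, (-1 : ℂ) ^ n * q ^ ((5 * n ^ 2 + 3 * n) / 2)) = t
  rw [← mul_right_inj' hD]
  field_simp
  linear_combination t * hprod

theorem phi_identity :
    x ^ (-2 : ℤ) * psi (q ^ 3) + (ω * phi (ω * x) - ω ^ 2 * phi (ω ^ 2 * x)) / (ω - ω ^ 2)
      = (thetaAlt x / thetaAlt q) *
        ((∑' n : ℤ, (-1 : ℂ) ^ n * q ^ ((5 * n ^ 2 + n) / 2)) / qPoch q (q ^ 2)) := by
  obtain ⟨hx0, hx1, hs3, hs2⟩ := root_mul_data hq0 hq1 hx hω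
  obtain ⟨A, B, hA, hB, hA0, f0, f1, f2, n1, n2, hprod⟩ := thetaAlt_data hq0 hq1 hx hω
  have s := summable_phi hx0 hx1
  have hE := qPoch_self_ne_zero hq1
  have hh : qPoch q (q ^ 2) ≠ 0 := qPoch_ne_zero_of_norm_lt (norm_pow_lt_one hq1 two_ne_zero) hq1
  have hD := mul_ne_zero hA0 (mul_ne_zero n1 n2)
  -- The prefactor `ω` of `φ(ωx)` rotates the residue parts cyclically.
  have hcomb := root_combination_left (P₀ := residuePart altWeight phiExp x 2)
    (P₁ := residuePart altWeight phiExp x 0) (P₂ := residuePart altWeight phiExp x 1) hω hA0 n1 n2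
  rw [bilinear_phi hq0 hq1 hx hA hB] at hcomb
  have hpsi : x ^ (-2 : ℤ) * psi (q ^ 3) = residuePart altWeight phiExp x 1 / A := by
    rw [psi_eq, residuePart_phi hx0 hx, ← hA]
    ring
  have h1 : ω * phi (ω * x) = (residuePart altWeight phiExp x 2
      + ω * residuePart altWeight phiExp x 0 + ω ^ 2 * residuePart altWeight phiExp x 1)
      / (A + ω * B) := by
    rw [phi_eq, tsum_root_mul hω.pow_eq_one s, f1, ← mul_div_assoc]
    congr 1
    linear_combination residuePart altWeight phiExp x 2 * hω.pow_eq_one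
  have h2 : ω ^ 2 * phi (ω ^ 2 * x) = (residuePart altWeight phiExp x 2
      + ω ^ 2 * residuePart altWeight phiExp x 0 + ω * residuePart altWeight phiExp x 1)
      / (A + ω ^ 2 * B) := by
    rw [phi_eq, tsum_root_mul hs3 s, f2, ← mul_div_assoc]
    congr 1
    linear_combination residuePart altWeight phiExp x 2 * hs3
      + residuePart altWeight phiExp x 1 * hs2
  rw [hpsi, h1, h2, hcomb, f0, thetaAlt_eq hq0 hq1]
  generalize A * ((A + ω * B) * (A + ω ^ 2 * B)) = D at hprod hD ⊢
  generalize (∑' n : ℤ, (-1 : ℂ) ^ n * q ^ ((5 * n ^ 2 + n) / 2)) = t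
  rw [← mul_right_inj' hD]
  field_simp
  linear_combination -t * hprod

theorem chi_identity :
    bigX (q ^ 3) - (ω * chi (ω * x) - ω ^ 2 * chi (ω ^ 2 * x)) / (ω - ω ^ 2)
      = (thetaTri x / thetaTri q) *
        ((∑' n : ℤ, (-1 : ℂ) ^ n * q ^ (5 * n ^ 2 + n)) / qPoch (-q) q) := by
  obtain ⟨hx0, hx1, hs3, hs2⟩ := root_mul_data hq0 hq1 hx hω
  obtain ⟨A, B, hA, hB, hB0, f0, f1, f2, n1, n2, hprod⟩ := thetaTri_data hq0 hq1 hx hω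
  have s := summable_chi hx0 hx1
  have hE := qPoch_self_ne_zero hq1
  have hN : qPoch (-q) q ≠ 0 := qPoch_ne_zero_of_norm_lt hq1 (by rwa [norm_neg])
  have hD := mul_ne_zero hB0 (mul_ne_zero n1 n2)
  have h3 := root_sub_sq_ne_zero hω
  have hT3 : thetaTri (q ^ 3) ≠ 0 := fun h => hB0 (by rw [hB, h, mul_zero])
  -- The prefactor `ω` and the factor `ωx` inside `χ(ωx)` rotate the residue parts twice.
  have hcomb := root_combination_right (P₀ := residuePart rhoWeight chiExp x 1)
    (P₁ := residuePart rhoWeight chiExp x 2) (P₂ := residuePart rhoWeight chiExp x 0) hω hB0 n1 n2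
  rw [bilinear_chi hq0 hq1 hx hA hB] at hcomb
  have hX : bigX (q ^ 3) = 2 - 2 * x * (residuePart rhoWeight chiExp x 0 / B) := by
    rw [bigX_eq, residuePart_chi hq0 hq1 hx, hB]
    field_simp
    ring
  have h1 : ω * chi (ω * x) = 2 * ω - 2 * x * ((residuePart rhoWeight chiExp x 1
      + ω * residuePart rhoWeight chiExp x 2 + ω ^ 2 * residuePart rhoWeight chiExp x 0)
      / (A + ω * B)) := by
    rw [chi_eq, tsum_root_mul hω.pow_eq_one s, f1]
    field_simp
    linear_combination -x * (residuePart rhoWeight chiExp x 1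
      + ω * residuePart rhoWeight chiExp x 2) * hω.pow_eq_one
  have h2 : ω ^ 2 * chi (ω ^ 2 * x) = 2 * ω ^ 2 - 2 * x * ((residuePart rhoWeight chiExp x 1
      + ω ^ 2 * residuePart rhoWeight chiExp x 2 + ω * residuePart rhoWeight chiExp x 0)
      / (A + ω ^ 2 * B)) := by
    rw [chi_eq, tsum_root_mul hs3 s, f2]
    field_simp
    linear_combination -x * (residuePart rhoWeight chiExp x 1
      + ω ^ 2 * residuePart rhoWeight chiExp x 2) * hs3
      - x * residuePart rhoWeight chiExp x 0 * hs2
  -- The constant 2 of `hX` cancels against the constants 2 of the two values of `χ`.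
  have key : ∀ a b c : ℂ, 2 - 2 * x * c - (2 * ω - 2 * x * a - (2 * ω ^ 2 - 2 * x * b))
      / (ω - ω ^ 2) = 2 * x * (-c + (a - b) / (ω - ω ^ 2)) := fun a b c => by
    linear_combination -2 * mul_inv_cancel₀ h3
  rw [hX, h1, h2, key, hcomb, f0]
  rw [thetaTri_eq hq0 hq1, ← qPoch_mul_neg q hq1]
  rw [thetaTri_eq hq0 hq1] at hprod
  generalize B * ((A + ω * B) * (A + ω ^ 2 * B)) = D at hprod hD ⊢
  generalize (∑' n : ℤ, (-1 : ℂ) ^ n * q ^ (5 * n ^ 2 + n)) = t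
  rw [← mul_right_inj' hD]
  field_simp
  linear_combination -t * hprod

theorem bigX_identity :
    chi (q ^ 3) + x ^ 2 * ((bigX (ω * x) - bigX (ω ^ 2 * x)) / (ω - ω ^ 2))
      = -q * (thetaTri x / thetaTri q) *
        ((∑' n : ℤ, (-1 : ℂ) ^ n * q ^ (5 * n ^ 2 + 3 * n)) / qPoch (-q) q) := by
  obtain ⟨hx0, hx1, hs3, hs2⟩ := root_mul_data hq0 hq1 hx hω
  obtain ⟨A, B, hA, hB, hB0, f0, f1, f2, n1, n2, hprod⟩ := thetaTri_data hq0 hq1 hx hω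
  have s := summable_bigX hx0 hx1
  have hE := qPoch_self_ne_zero hq1
  have hN : qPoch (-q) q ≠ 0 := qPoch_ne_zero_of_norm_lt hq1 (by rwa [norm_neg])
  have hD := mul_ne_zero hB0 (mul_ne_zero n1 n2)
  have hT3 : thetaTri (q ^ 3) ≠ 0 := fun h => hB0 (by rw [hB, h, mul_zero])
  have hcomb := root_combination_right (P₀ := residuePart rhoWeight bigXExp x 0)
    (P₁ := residuePart rhoWeight bigXExp x 1) (P₂ := residuePart rhoWeight bigXExp x 2)
    hω hB0 n1 n2
  rw [bilinear_bigX hq0 hq1 hx hA hB] at hcomb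
  have hC : chi (q ^ 3) = 2 * x ^ 2 * -(residuePart rhoWeight bigXExp x 2 / B) := by
    rw [chi_eq, mul_assoc 2, residuePart_bigX hq0 hq1 hx, hB]
    field_simp
    ring
  rw [hC, bigX_eq, bigX_eq, tsum_root_mul hω.pow_eq_one s, tsum_root_mul hs3 s, hs2, f1, f2,
    mul_div_assoc, mul_div_assoc, ← mul_sub, mul_div_assoc 2, ← mul_assoc (x ^ 2),
    mul_comm (x ^ 2) 2, ← mul_add, hcomb, f0]
  rw [thetaTri_eq hq0 hq1, ← qPoch_mul_neg q hq1]
  rw [thetaTri_eq hq0 hq1] at hprod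
  generalize B * ((A + ω * B) * (A + ω ^ 2 * B)) = D at hprod hD ⊢
  generalize (∑' n : ℤ, (-1 : ℂ) ^ n * q ^ (5 * n ^ 2 + 3 * n)) = t
  rw [← mul_right_inj' hD]
  field_simp
  linear_combination t * q * hprod - 16 * x * t * qPoch (-q) q ^ 8 * qPoch q q ^ 4 * hx

end

end TenthOrder

end

/-- The first four of Ramanujan's identities between the tenth order mock theta functions. Here
`x` is a cube root `q^{1/3}` of `q`, and the fractional powers of `q` are the powers of `x`:
`q^{2/3} = x^2`, `q^{n^2/3} = x^{n^2}`, `q^{n(n+1)/6} = x^{n(n+1)/2}`. All integer divisions by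
`2` in exponents are exact. -/
theorem mainTheorem2 (q x ω : ℂ) (hq0 : q ≠ 0) (hq1 : ‖q‖ < 1) (hx : x ^ 3 = q)
    (hω : IsPrimitiveRoot ω 3) :
    x ^ 2 * TenthOrder.phi (q ^ 3)
        - (TenthOrder.psi (ω * x) - TenthOrder.psi (ω ^ 2 * x)) / (ω - ω ^ 2)
      = - x * ((∑' n : ℤ, (-1 : ℂ) ^ n * x ^ (n ^ 2)) / (∑' n : ℤ, (-1 : ℂ) ^ n * q ^ (n ^ 2)))
          * ((∑' n : ℤ, (-1 : ℂ) ^ n * q ^ ((5 * n ^ 2 + 3 * n) / 2))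
              / TenthOrder.qPoch q (q ^ 2)) ∧
    x ^ (-2 : ℤ) * TenthOrder.psi (q ^ 3)
        + (ω * TenthOrder.phi (ω * x) - ω ^ 2 * TenthOrder.phi (ω ^ 2 * x)) / (ω - ω ^ 2)
      = ((∑' n : ℤ, (-1 : ℂ) ^ n * x ^ (n ^ 2)) / (∑' n : ℤ, (-1 : ℂ) ^ n * q ^ (n ^ 2)))
          * ((∑' n : ℤ, (-1 : ℂ) ^ n * q ^ ((5 * n ^ 2 + n) / 2))
              / TenthOrder.qPoch q (q ^ 2)) ∧
    TenthOrder.bigX (q ^ 3)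
        - (ω * TenthOrder.chi (ω * x) - ω ^ 2 * TenthOrder.chi (ω ^ 2 * x)) / (ω - ω ^ 2)
      = ((∑' n : ℤ, x ^ (n * (n + 1) / 2)) / (∑' n : ℤ, q ^ (n * (n + 1) / 2)))
          * ((∑' n : ℤ, (-1 : ℂ) ^ n * q ^ (5 * n ^ 2 + n)) / TenthOrder.qPoch (-q) q) ∧
    TenthOrder.chi (q ^ 3)
        + x ^ 2 * ((TenthOrder.bigX (ω * x) - TenthOrder.bigX (ω ^ 2 * x)) / (ω - ω ^ 2))
      = - q * ((∑' n : ℤ, x ^ (n * (n + 1) / 2)) / (∑' n : ℤ, q ^ (n * (n + 1) / 2)))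
          * ((∑' n : ℤ, (-1 : ℂ) ^ n * q ^ (5 * n ^ 2 + 3 * n)) / TenthOrder.qPoch (-q) q) := by
  exact ⟨TenthOrder.psi_identity hq0 hq1 hx hω, TenthOrder.phi_identity hq0 hq1 hx hω,
    TenthOrder.chi_identity hq0 hq1 hx hω, TenthOrder.bigX_identity hq0 hq1 hx hω⟩
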